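/- Let $F$ be a non-archimedean local field with ring of integers $\mathcal O$, uniformizer $\pi$ and residue field of cardinality $q$. Let $G=\mathrm{SL}_2(F)$, let $I\subset \mathrm{SL}_2(\mathcal O)$ be the Iwahori subgroup of matrices whose lower left entry lies in $\pi\mathcal O$, and let $\tilde W=\langle s_0,s_1\mid s_0^2=s_1^2=1\rangle$ be the affine Weyl group, with length $\ell$ and strong Bruhat order $\le$. Here $s_0,s_1$ are represented in $G$ by $\begin{pmatrix}0&-1\\1&0\end{pmatrix}$ and $\begin{pmatrix}0&-\pi^{-1}\\ \pi&0\end{pmatrix}$. Let $H$ be the Iwahori–Hecke algebra of $\tilde W$ over $\mathbb Z[q^{1/2},q^{-1/2}]$ (with $q^{1/2}$ a variable), with standard basis $T_w$ and involution $j(\sum a_wT_w)=\sum\overline{a_w}(-1)^{\ell(w)}q^{-\ell(w)}T_w$, where $\overline{q^{1/2}}=q^{-1/2}$. Let $C'_w=q^{-\ell(w)/2}\sum_{y\le w}T_y$ and $C_w=(-1)^{\ell(w)}j(C'_w)$ be the Kazhdan–Lusztig bases, and write $C_xC_y=\sum_z h_{x,y,z}C_z$. Let $J$ be Lusztig's asymptotic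 Hecke algebra, with basis $(t_w)_{w\in\tilde W}$, let $a$ be Lusztig's $a$-function, and let $$\phi\Big(\sum_x b_xC_x\Big)=\sum_{x,z}\ \sum_{d\in\{1,s_0,s_1\},\ a(d)=a(z)} b_x h_{x,d,z}\,t_z$$ be Lusztig's map. It is considered from the completion of $H$ consisting of the sums $\sum_x b_xC_x$ with $b_x\in\mathbb Z((q^{1/2}))$ and $b_x\to0$ as $\ell(x)\to\infty$, to the analogous completion of $J$. The involution $j$ extends to a map from the completion consisting of the sums $\sum_x b_xC'_x$ with $b_x\in\mathbb Z((q^{-1/2}))$ and $b_x\to 0$ to the former completion of $H$. Then there is exactly one element of this last completion, again denoted $t_1$, that $\phi\circ j$ maps to the basis element $t_1$ of $J$. Expanded in the $T_w$ it is the scalar multiple $$t_1=\frac{1-q^{-1}}{1+q^{-1}}\;g,\qquad g=\sum_{w\in\tilde W}(-1)^{\ell(w)}q^{-\ell(w)}T_w .$$ Now specialize $q$ to the cardinality of the residue field; the coefficients of $t_1$ in the $T_w$ converge. View $T_w$ as the characteristic function of $IwI$, acting on $I$-invariant functions on $F^2\setminus\{0\}$ by convolution, $(T_w\star f)(x)=\sum_{\gamma\in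 IwI/I}f(\gamma^{-1}x)$. For $m\in\mathbb Z$ let $\psi_m$ and $\varphi_m$ be the characteristic functions of the $I$-orbits $$\begin{pmatrix}\pi^m\mathcal O^\times\\ \pi^{m+1}\mathcal O\end{pmatrix},\qquad \begin{pmatrix}\pi^m\mathcal O\\ \pi^{m}\mathcal O^\times\end{pmatrix}$$ in $F^2\setminus\{0\}$. Then for every $m\in\mathbb Z$ the series defining $t_1\star\psi_m$ and $t_1\star\varphi_m$ (the sum over $w$ of the coefficient of $T_w$ in $t_1$ times $T_w\star\psi_m$, respectively $T_w\star\varphi_m$) converge absolutely at every point of $F^2\setminus\{0\}$, and $$t_1\star\psi_m=t_1\star\varphi_m=0 .$$ -/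

import Mathlib

open ValuativeRel
open scoped LaurentPolynomial LaurentSeries MatrixGroups

noncomputable section

namespace AffineSL2

/-! ## The affine Weyl group `⟨s₀, s₁ | s₀² = s₁² = 1⟩` of `SL₂` -/

/-- The affine Weyl group of `SL₂`, i.e. the infinite dihedral group. The rotation `r n` is the
translation `π^n`, and `sr n = s₀ π^n`. -/
abbrev W : Type := DihedralGroup 0

/-- The simple reflections: `s₀` generates the finite Weyl group and `s₁ = s₀ π` is the affine
reflection; one has `s₀ s₁ = π`. -/
def s (i : Fin 2) : W := if i = 0 then .sr 0 else .sr 1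

/-- The product of a word in the simple reflections. -/
def wordProd (l : List (Fin 2)) : W := (l.map s).prod

/-- The Coxeter length: the least number of letters of a word with product `w`. -/
def length (w : W) : ℕ := sInf {n | ∃ l : List (Fin 2), l.length = n ∧ wordProd l = w}

/-- The alternating word with `n` letters whose first letter is `i`. -/
def altWord : Fin 2 → ℕ → List (Fin 2)
  | _, 0 => []
  | i, n + 1 => i :: altWord (1 - i) n

/-- The (unique) reduced word of `w`. -/
def reducedWord : W → List (Fin 2)
  | .r n => let k : ℤ := n
    if 0 ≤ k then altWord 0 (2 * k.natAbs) else altWord 1 (2 * k.natAbs)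
  | .sr n => let k : ℤ := n
    if k ≤ 0 then altWord 0 (2 * k - 1).natAbs else altWord 1 (2 * k - 1).natAbs

theorem length_altWord (i : Fin 2) (n : ℕ) : (altWord i n).length = n := by
  induction n generalizing i with
  | zero => rfl
  | succ n ih => simp [altWord, ih]

theorem wordProd_cons (i : Fin 2) (l : List (Fin 2)) : wordProd (i :: l) = s i * wordProd l := by
  simp [wordProd]

theorem wordProd_altWord (n : ℕ) :
    wordProd (altWord 0 (2 * n)) = .r (n : ℤ) ∧ wordProd (altWord 1 (2 * n)) = .r (-n : ℤ) ∧
    wordProd (altWord 0 (2 * n + 1)) = .sr (-n : ℤ) ∧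
    wordProd (altWord 1 (2 * n + 1)) = .sr (n + 1 : ℤ) := by
  have key : ∀ m : ℕ, wordProd (altWord 0 (2 * m)) = .r (m : ℤ) →
      wordProd (altWord 1 (2 * m)) = .r (-m : ℤ) →
      wordProd (altWord 0 (2 * m + 1)) = .sr (-m : ℤ) ∧
      wordProd (altWord 1 (2 * m + 1)) = .sr (m + 1 : ℤ) := by
    intro m h0 h1
    refine ⟨?_, ?_⟩
    · rw [altWord, wordProd_cons, show (1 - 0 : Fin 2) = 1 from rfl, h1, s, if_pos rfl]
      exact congrArg (DihedralGroup.sr (n := 0)) (zero_add (-(m : ℤ)))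
    · rw [altWord, wordProd_cons, show (1 - 1 : Fin 2) = 0 from rfl, h0, s, if_neg (by decide)]
      exact congrArg (DihedralGroup.sr (n := 0)) (add_comm (1 : ℤ) (m : ℤ))
  have main : wordProd (altWord 0 (2 * n)) = .r (n : ℤ) ∧
      wordProd (altWord 1 (2 * n)) = .r (-n : ℤ) := by
    induction n with
    | zero => exact ⟨rfl, rfl⟩
    | succ n ih =>
      obtain ⟨h0, h1⟩ := key n ih.1 ih.2
      refine ⟨?_, ?_⟩
      · rw [show 2 * (n + 1) = (2 * n + 1) + 1 from rfl, altWord, wordProd_cons,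
          show (1 - 0 : Fin 2) = 1 from rfl, h1, s, if_pos rfl]
        exact congrArg (DihedralGroup.r (n := 0)) (by push_cast; ring : ((n : ℤ) + 1 - 0) = ((n + 1 : ℕ) : ℤ))
      · rw [show 2 * (n + 1) = (2 * n + 1) + 1 from rfl, altWord, wordProd_cons,
          show (1 - 1 : Fin 2) = 0 from rfl, h0, s, if_neg (by decide)]
        exact congrArg (DihedralGroup.r (n := 0)) (by push_cast; ring : (-(n : ℤ) - 1) = -((n + 1 : ℕ) : ℤ))
  exact ⟨main.1, main.2, key n main.1 main.2⟩

theorem wordProd_reducedWord (w : W) : wordProd (reducedWord w) = w := by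
  rcases w with n | n
  · change ℤ at n
    by_cases h : 0 ≤ n
    · obtain ⟨m, rfl⟩ := Int.eq_ofNat_of_zero_le h
      simpa [reducedWord, h] using (wordProd_altWord m).1
    · obtain ⟨m, rfl⟩ := Int.exists_eq_neg_ofNat (le_of_not_ge h)
      simp only [reducedWord, if_neg h, Int.natAbs_neg, Int.natAbs_natCast]
      exact (wordProd_altWord m).2.1
  · change ℤ at n
    by_cases h : n ≤ 0
    · obtain ⟨m, rfl⟩ := Int.exists_eq_neg_ofNat h
      simp only [reducedWord, if_pos h]
      rw [show (2 * (-(m : ℤ)) - 1).natAbs = 2 * m + 1 by omega]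
      exact (wordProd_altWord m).2.2.1
    · obtain ⟨m, rfl⟩ : ∃ m : ℕ, n = m + 1 := ⟨(n - 1).toNat, by omega⟩
      simp only [reducedWord, if_neg h]
      rw [show (2 * ((m : ℤ) + 1) - 1).natAbs = 2 * m + 1 by omega]
      exact (wordProd_altWord m).2.2.2

theorem length_reducedWord_le (l : List (Fin 2)) :
    (reducedWord (wordProd l)).length ≤ l.length := by
  have hr : ∀ n : ℤ, (reducedWord (.r n)).length = 2 * n.natAbs := by
    intro n
    by_cases h : 0 ≤ n <;> simp [reducedWord, h, length_altWord]
  have hsr : ∀ n : ℤ, (reducedWord (.sr n)).length = (2 * n - 1).natAbs := by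
    intro n
    by_cases h : n ≤ 0 <;> simp [reducedWord, h, length_altWord]
  induction l with
  | nil => exact (hr 0).le
  | cons i l ih =>
    rw [wordProd_cons, List.length_cons]
    generalize wordProd l = w at ih
    rcases w with n | n
    · change ℤ at n
      rw [hr n] at ih
      fin_cases i
      · have : s 0 * DihedralGroup.r n = DihedralGroup.sr (0 + n : ℤ) := rfl
        simp only [Fin.zero_eta, this, hsr]
        omega
      · have : s 1 * DihedralGroup.r n = DihedralGroup.sr (1 + n : ℤ) := rfl
        simp only [Fin.mk_one, this, hsr]
        omega
    · change ℤ at n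
      rw [hsr n] at ih
      fin_cases i
      · have : s 0 * DihedralGroup.sr n = DihedralGroup.r (n - 0 : ℤ) := rfl
        simp only [Fin.zero_eta, this, hr]
        omega
      · have : s 1 * DihedralGroup.sr n = DihedralGroup.r (n - 1 : ℤ) := rfl
        simp only [Fin.mk_one, this, hr]
        omega

theorem length_reducedWord (w : W) : (reducedWord w).length = length w := by
  apply le_antisymm
  · obtain ⟨l, hl, hw⟩ := Nat.sInf_mem
      (s := {n | ∃ l : List (Fin 2), l.length = n ∧ wordProd l = w})
      ⟨_, reducedWord w, rfl, wordProd_reducedWord w⟩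
    have := length_reducedWord_le l
    rw [hw, hl] at this
    exact this
  · exact Nat.sInf_le ⟨reducedWord w, rfl, wordProd_reducedWord w⟩

/-- The set of all `y ≤ w` in the strong Bruhat order: the products of the words obtained by
deleting letters from the reduced word of `w`. -/
def bruhatIic (w : W) : Finset W := ((reducedWord w).sublists.map wordProd).toFinset

theorem self_mem_bruhatIic (w : W) : w ∈ bruhatIic w := by
  simp only [bruhatIic, List.mem_toFinset, List.mem_map, List.mem_sublists]
  exact ⟨reducedWord w, List.Sublist.refl _, wordProd_reducedWord w⟩

theorem length_lt_of_mem_bruhatIic {y w : W} (h : y ∈ bruhatIic w) (hne : y ≠ w) :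
    length y < length w := by
  simp only [bruhatIic, List.mem_toFinset, List.mem_map, List.mem_sublists] at h
  obtain ⟨l, hl, rfl⟩ := h
  have h1 : length (wordProd l) ≤ l.length := Nat.sInf_le ⟨l, rfl, rfl⟩
  have h2 := hl.length_le
  rw [← length_reducedWord w]
  rcases h2.lt_or_eq with h3 | h3
  · omega
  · exact absurd (by rw [hl.eq_of_length h3, wordProd_reducedWord]) hne

/-! ## The Iwahori-Hecke algebra `H` over `𝒜 = ℤ[q^{1/2}, q^{-1/2}]` -/

/-- The ring `𝒜 = ℤ[v, v⁻¹]`, where `v = q^{1/2}` is the Laurent variable `T 1`. -/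
abbrev A : Type := ℤ[T;T⁻¹]

/-- The power `v^n` of `v = q^{1/2}`. -/
abbrev v (n : ℤ) : A := LaurentPolynomial.T n

/-- The Iwahori-Hecke algebra as an `𝒜`-module: free on the basis `T_w = Finsupp.single w 1`. -/
abbrev H : Type := W →₀ A

/-- The basis element `T_w`. -/
def T (w : W) : H := Finsupp.single w 1

/-- Left multiplication by `T_s` for `s = s i`: `T_s T_w = T_{sw}` if `ℓ(sw) > ℓ(w)`, and
`T_s T_w = (q - 1) T_w + q T_{sw}` otherwise. -/
def mulGen (i : Fin 2) : H →ₗ[A] H :=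
  Finsupp.linearCombination A fun w =>
    if length w < length (s i * w) then T (s i * w) else (v 2 - 1) • T w + v 2 • T (s i * w)

/-- Left multiplication by `T_w`, `T_w = T_{s_{i₁}} ⋯ T_{s_{iₙ}}` for the reduced word of `w`. -/
def mulT (w : W) : H →ₗ[A] H := ((reducedWord w).map mulGen).prod

/-- The multiplication of `H`. -/
def mul (x y : H) : H := x.sum fun w a => a • mulT w y

/-- The involution `j (∑ a_w T_w) = ∑ \bar{a_w} (-1)^{ℓ(w)} q^{-ℓ(w)} T_w`, where `v ↦ v⁻¹` under
the bar. -/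
def j (x : H) : H :=
  x.sum fun w a => (LaurentPolynomial.invert a * (-1) ^ length w * v (-2 * length w)) • T w

/-- The Kazhdan-Lusztig element `C'_w = q^{-ℓ(w)/2} ∑_{y ≤ w} T_y`; for the infinite dihedral group
the Kazhdan-Lusztig polynomials `P_{y,w}`, `y ≤ w`, are all equal to `1`. -/
def C' (w : W) : H := v (-length w) • ∑ y ∈ bruhatIic w, T y

/-- The Kazhdan-Lusztig element `C_w = (-1)^{ℓ(w)} j(C'_w)`. -/
def C (w : W) : H := (-1 : A) ^ length w • j (C' w)

theorem j_apply (x : H) (y : W) :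
    j x y = LaurentPolynomial.invert (x y) * (-1) ^ length y * v (-2 * length y) := by
  rw [j, Finsupp.sum, Finsupp.finsetSum_apply]
  rw [Finset.sum_eq_single y]
  · simp [T]
  · intro b _ hb
    simp [T, hb]
  · intro hy
    simp [Finsupp.notMem_support_iff.mp hy]

theorem C'_apply (w y : W) : C' w y = if y ∈ bruhatIic w then v (-length w) else 0 := by
  rw [C', Finsupp.smul_apply, Finsupp.finsetSum_apply]
  by_cases hy : y ∈ bruhatIic w
  · rw [Finset.sum_eq_single y]
    · simp [T, hy]
    · intro b _ hb
      simp [T, hb]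
    · exact fun hn => absurd hy hn
  · rw [Finset.sum_eq_zero]
    · simp [hy]
    · intro b hb
      have : b ≠ y := fun e => hy (e ▸ hb)
      simp [T, this]

theorem C_apply (w y : W) : C w y =
    if y ∈ bruhatIic w then
      (-1) ^ length w * ((-1) ^ length y * v (length w - 2 * length y)) else 0 := by
  rw [C, Finsupp.smul_apply, j_apply, C'_apply]
  split_ifs with hy
  · simp only [v]
    rw [LaurentPolynomial.invert_T, smul_eq_mul, neg_neg, sub_eq_add_neg,
      LaurentPolynomial.T_add, neg_mul]
    ring
  · simp

theorem C_apply_self (w : W) : C w w = v (-length w) := by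
  rw [C_apply, if_pos (self_mem_bruhatIic w), ← mul_assoc, ← mul_pow]
  simp only [mul_neg, mul_one, neg_neg, one_pow, one_mul]
  congr 1
  ring

theorem linearIndependent_C : LinearIndependent A C := by
  rw [linearIndependent_iff]
  intro c hc
  by_contra hne
  obtain ⟨w, hw, hmax⟩ := c.support.exists_max_image length (Finsupp.support_nonempty_iff.mpr hne)
  have h1 : Finsupp.linearCombination A C c w = c w * v (-length w) := by
    rw [Finsupp.linearCombination_apply, Finsupp.sum, Finsupp.finsetSum_apply,
      Finset.sum_eq_single w]
    · rw [Finsupp.smul_apply, C_apply_self, smul_eq_mul]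
    · intro x hx hxw
      rw [Finsupp.smul_apply, C_apply, if_neg, smul_zero]
      intro hmem
      have := length_lt_of_mem_bruhatIic hmem hxw.symm
      have := hmax x hx
      omega
    · intro hn
      simp [Finsupp.notMem_support_iff.mp hn]
  rw [hc, Finsupp.zero_apply] at h1
  have h2 : c w = c w * v (-length w) * v (length w) := by
    rw [mul_assoc, v, v, ← LaurentPolynomial.T_add, neg_add_cancel, LaurentPolynomial.T_zero,
      mul_one]
  rw [← h1, zero_mul] at h2
  exact (Finsupp.mem_support_iff.mp hw) h2

theorem span_C : ⊤ ≤ Submodule.span A (Set.range C) := by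
  have key : ∀ n : ℕ, ∀ w : W, length w = n → T w ∈ Submodule.span A (Set.range C) := by
    intro n
    induction n using Nat.strong_induction_on with
    | _ n ih =>
      intro w hw
      have h1 : v (length w) • C w - T w ∈ Submodule.span A (Set.range C) := by
        rw [← Finsupp.sum_single (v (length w) • C w - T w), Finsupp.sum]
        refine Submodule.sum_mem _ fun y hy => ?_
        rw [← mul_one ((v (length w) • C w - T w) y), ← smul_eq_mul, ← Finsupp.smul_single]
        refine Submodule.smul_mem _ _ ?_
        have hyw : y ≠ w := by
          rintro rfl
          refine (Finsupp.mem_support_iff.mp hy) ?_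
          rw [Finsupp.sub_apply, Finsupp.smul_apply, C_apply_self, smul_eq_mul, v, v,
            ← LaurentPolynomial.T_add, add_neg_cancel, LaurentPolynomial.T_zero, T,
            Finsupp.single_eq_same, sub_self]
        have hmem : y ∈ bruhatIic w := by
          by_contra hn
          refine (Finsupp.mem_support_iff.mp hy) ?_
          rw [Finsupp.sub_apply, Finsupp.smul_apply, C_apply, if_neg hn, T,
            Finsupp.single_eq_of_ne hyw, smul_zero, sub_zero]
        exact ih _ (hw ▸ length_lt_of_mem_bruhatIic hmem hyw) y rfl
      have h2 : v (length w) • C w ∈ Submodule.span A (Set.range C) :=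
        Submodule.smul_mem _ _ (Submodule.subset_span ⟨w, rfl⟩)
      simpa using Submodule.sub_mem _ h2 h1
  intro x _
  rw [← Finsupp.sum_single x, Finsupp.sum]
  refine Submodule.sum_mem _ fun y _ => ?_
  rw [← mul_one (x y), ← smul_eq_mul, ← Finsupp.smul_single]
  exact Submodule.smul_mem _ _ (key _ y rfl)

/-- The elements `C_w` form a basis of `H`. -/
def basisC : Module.Basis W A H := Module.Basis.mk linearIndependent_C span_C

/-- The structure constants `h_{x,y,z}`, given by `C_x C_y = ∑_z h_{x,y,z} C_z`. -/
def h (x y z : W) : A := basisC.repr (mul (C x) (C y)) z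

/-- Lusztig's `a`-function: `a(z)` is the least `n` such that `(-v)^n h_{x,y,z} ∈ ℤ[v]` for all
`x` and `y`. -/
def a (z : W) : ℕ :=
  sInf {n | ∀ x y : W, (-v 1) ^ n * h x y z ∈ Set.range (Polynomial.toLaurent (R := ℤ))}

/-- The distinguished involutions. -/
def distinguished : Finset W := {1, s 0, s 1}

/-! ## Completions, the asymptotic Hecke algebra and the map `φ ∘ j` -/

/-- `f : W → ℤ((X))` tends to `0`: for every `N` one has `f x ∈ X^N ℤ[[X]]` as soon as `ℓ(x)` is
large enough. -/
def IsNull (f : W → ℤ⸨X⸩) : Prop :=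
  ∀ N : ℕ, ∃ L : ℕ, ∀ x, L ≤ length x → ∀ n : ℤ, n < N → (f x).coeff n = 0

/-- The formal sum of the family `f` of Laurent series exists and is `S`. -/
def HasFormalSum (f : W → ℤ⸨X⸩) (S : ℤ⸨X⸩) : Prop :=
  ∃ F : HahnSeries.SummableFamily ℤ ℤ W, (∀ x, F x = f x) ∧ F.hsum = S

/-- The embedding `ℤ[v, v⁻¹] → ℤ((v))`. -/
def toSeries (p : A) : ℤ⸨X⸩ := HahnSeries.ofFinsupp p.coeff

/-- Elements of the completion of `H` with respect to positive powers of `v` are the sums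
`∑ b_x C_x` with `b_x ∈ ℤ((v))` tending to `0`; elements of the completed asymptotic algebra `𝒥`
are the sums `∑ c_z t_z` with `c_z ∈ ℤ((v))` tending to `0`. `IsPhi b c` says that Lusztig's map
`φ` sends the former to the latter, where
`φ (∑ b_x C_x) = ∑_{x, z, d ∈ 𝒟, a(d) = a(z)} b_x h_{x,d,z} t_z`. -/
def IsPhi (b c : W → ℤ⸨X⸩) : Prop :=
  IsNull b ∧ IsNull c ∧
    ∀ z, HasFormalSum (fun x => ∑ d ∈ distinguished with a d = a z, b x * toSeries (h x d z)) (c z)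

/-- Elements of the completion of `H` with respect to negative powers of `v` are the sums
`∑ b_x C'_x` with `b_x ∈ ℤ((v⁻¹))` tending to `0`. The map `j` sends such a sum to
`∑ (-1)^{ℓ(x)} \bar{b_x} C_x`; here the bar maps `ℤ((v⁻¹))` to `ℤ((v))` by `v⁻¹ ↦ v`, hence is the
identity when both rings are written as `ℤ((X))`, with `X = v⁻¹` in the former and `X = v` in the
latter. -/
def jCompletion (b : W → ℤ⸨X⸩) : W → ℤ⸨X⸩ := fun x => (-1) ^ length x * b x

/-- The basis element `t_y` of the asymptotic Hecke algebra `J`, as an element of `𝒥`. -/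
def asympBasis (y : W) : W → ℤ⸨X⸩ := Pi.single y 1

/-- `IsAsympElement y t` says that `∑_w t_w T_w`, with `t_w ∈ ℤ((v⁻¹))` and `X = v⁻¹`, is the
expansion of `(φ ∘ j)⁻¹ (t_y)`: there is an element `∑ b_x C'_x` of the completion of `H` with
respect to negative powers of `v` which `φ ∘ j` maps to `t_y`, and substituting
`C'_x = v^{-ℓ(x)} ∑_{w ≤ x} T_w` gives the coefficients `t_w`. -/
def IsAsympElement (y : W) (t : W → ℤ⸨X⸩) : Prop :=
  ∃ b : W → ℤ⸨X⸩, IsNull b ∧ IsPhi (jCompletion b) (asympBasis y) ∧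
    ∀ w, HasFormalSum
      (fun x => if w ∈ bruhatIic x then HahnSeries.single (length x : ℤ) 1 * b x else 0) (t w)

/-- The coefficients of `g = ∑_w (-1)^{ℓ(w)} q^{-ℓ(w)} T_w`, where `X = q^{-1/2}`. -/
def g (w : W) : ℤ⸨X⸩ := (-1) ^ length w * HahnSeries.single (2 * length w : ℤ) 1

/-! ## The group `SL₂(F)` and its action on the plane -/

section Plane

variable (F : Type*) [Field F] [ValuativeRel F]

/-- The Iwahori subgroup `I` of `SL₂(F)`: integral entries, and lower left entry in the maximal
ideal. -/
def iwahori : Subgroup SL(2, F) where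
  carrier := {g | (∀ i k, valuation F (g i k) ≤ 1) ∧ valuation F (g 1 0) < 1}
  one_mem' := by
    refine ⟨fun i k => ?_, by simp⟩
    fin_cases i <;> fin_cases k <;> simp
  mul_mem' := by
    rintro x y ⟨hx, hx'⟩ ⟨hy, hy'⟩
    refine ⟨fun i k => ?_, ?_⟩
    · rw [Matrix.SpecialLinearGroup.coe_mul, Matrix.mul_apply, Fin.sum_univ_two]
      refine (valuation F).map_add_le ?_ ?_ <;> rw [map_mul]
      · exact mul_le_one' (hx _ _) (hy _ _)
      · exact mul_le_one' (hx _ _) (hy _ _)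
    · rw [Matrix.SpecialLinearGroup.coe_mul, Matrix.mul_apply, Fin.sum_univ_two]
      refine (valuation F).map_add_lt ?_ ?_ <;> rw [map_mul]
      · exact mul_lt_one_of_nonneg_of_lt_one_left zero_le hx' (hy _ _)
      · exact mul_lt_one_of_nonneg_of_lt_one_right (hx _ _) zero_le hy'
  inv_mem' := by
    rintro x ⟨hx, hx'⟩
    rw [Set.mem_ofPred_eq, Matrix.SpecialLinearGroup.SL2_inv_expl x]
    refine ⟨fun i k => ?_, ?_⟩
    · fin_cases i <;> fin_cases k <;> simp [hx]
    · simpa using hx'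

/-- The punctured plane `F² ∖ {0} = G/N`. -/
abbrev Plane : Type _ := {x : Fin 2 → F // x ≠ 0}

variable {F}

theorem uniformizer_ne_zero {ϖ : 𝒪[F]} (hϖ : Irreducible ϖ) : (ϖ : F) ≠ 0 := by
  simpa using hϖ.ne_zero

/-- The action of `SL₂(F)` on the punctured plane. -/
def act (g : SL(2, F)) (x : Plane F) : Plane F :=
  ⟨(g : Matrix (Fin 2) (Fin 2) F).mulVec x.1, fun h0 => x.2 <| by
    have h1 := congrArg ((g⁻¹ : SL(2, F)) : Matrix (Fin 2) (Fin 2) F).mulVec h0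
    rwa [Matrix.mulVec_mulVec, ← Matrix.SpecialLinearGroup.coe_mul, inv_mul_cancel,
      Matrix.SpecialLinearGroup.coe_one, Matrix.one_mulVec, Matrix.mulVec_zero] at h1⟩

/-- A representative of `w` in the normaliser of the diagonal torus: `diag(ϖ^n, ϖ^{-n})` for the
translation `r n`, and `s₀ diag(ϖ^n, ϖ^{-n})` with `s₀ = (0, -1; 1, 0)` for `sr n`. -/
def weylRep (ϖ : F) (hϖ : ϖ ≠ 0) : W → SL(2, F)
  | .r n => let k : ℤ := n
    ⟨!![ϖ ^ k, 0; 0, ϖ ^ (-k)], by simp [Matrix.det_fin_two_of, zpow_ne_zero, hϖ]⟩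
  | .sr n => let k : ℤ := n
    ⟨!![0, -ϖ ^ (-k); ϖ ^ k, 0], by simp [Matrix.det_fin_two_of, zpow_ne_zero, hϖ]⟩

/-- The set of cosets `IwI / I ⊆ SL₂(F) / I`. -/
def cell (ϖ : F) (hϖ : ϖ ≠ 0) (w : W) : Set (SL(2, F) ⧸ iwahori F) :=
  {c | ∃ i ∈ iwahori F, c = QuotientGroup.mk (i * weylRep ϖ hϖ w)}

/-- The convolution `T_w ⋆ f` of the characteristic function `T_w` of `IwI` with an `I`-invariant
function `f` on the punctured plane, for the Haar measure of total mass `1` on `I`: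
`(T_w ⋆ f)(x) = ∑_{γ ∈ IwI/I} f(γ⁻¹ x)`. For `f` the characteristic function of an `I`-orbit `X`
this is the number of points in the fibre over `x` of `IwI ×_I X → G/N`. -/
def conv (ϖ : F) (hϖ : ϖ ≠ 0) (w : W) (f : Plane F → ℂ) (x : Plane F) : ℂ :=
  ∑ᶠ c ∈ cell ϖ hϖ w, f (act (Quotient.out c)⁻¹ x)

/-- The characteristic function `ψ_m` of the `I`-orbit `(ϖ^m 𝒪ˣ, ϖ^{m+1} 𝒪)`. -/
def psi (ϖ : F) (m : ℤ) : Plane F → ℂ :=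
  Set.indicator {x | valuation F (x.1 0) = valuation F ϖ ^ m ∧
    valuation F (x.1 1) ≤ valuation F ϖ ^ (m + 1)} 1

/-- The characteristic function `φ_m` of the `I`-orbit `(ϖ^m 𝒪, ϖ^m 𝒪ˣ)`. -/
def phi (ϖ : F) (m : ℤ) : Plane F → ℂ :=
  Set.indicator {x | valuation F (x.1 0) ≤ valuation F ϖ ^ m ∧
    valuation F (x.1 1) = valuation F ϖ ^ m} 1

/-- `τ ⋆ f = h` for `τ = ∑_w τ_w T_w`: at every point of the punctured plane the series
`∑_w τ_w (T_w ⋆ f)` converges (unconditionally) to `h`. -/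
def ActsTo (ϖ : F) (hϖ : ϖ ≠ 0) (τ : W → ℂ) (f h : Plane F → ℂ) : Prop :=
  ∀ x, HasSum (fun w => τ w * conv ϖ hϖ w f x) (h x)

end Plane

/-- `τ` is the value of the Laurent series `p ∈ ℤ((X))` at `X = q^{-1/2}`, where `q` is now a
number: the series converges to `τ`. -/
def Specializes (q : ℕ) (p : ℤ⸨X⸩) (τ : ℂ) : Prop :=
  HasSum (fun n : ℤ => ((p.coeff n : ℤ) : ℂ) * ((Real.sqrt q : ℝ) : ℂ) ^ (-n)) τ

end AffineSL2

end

/-!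
Write `v = q^{1/2}`. For `z ≠ 1` the coefficient of `t_z` in `φ (∑ b_x C_x)` is that of `C_z` in
`(∑ b_x C_x) (C_{s₀} + C_{s₁})`. Its vanishing is a three-term recurrence in `ℓ(x)` along each
family of alternating words, with characteristic roots `v` and `v⁻¹`. Since `b_x → 0`, only the
root `v` survives, so `∑ v^{ℓ(x)} C_x` is the unique preimage of `t_1`. Applying `j⁻¹`, the
coefficient of `T_w` is the sum of `(-q⁻¹)^{ℓ(x)}` over `x ≥ w`, and there are two such `x` in each
length above `ℓ(w)`: this geometric series is `(1 - q⁻¹) / (1 + q⁻¹)` times the coefficient of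
`T_w` in `g`.

For an `I`-orbit `S` and a Haar measure `μ` on the plane, averaging `T_w ⋆ 1_S` over `I x` gives
`(T_w ⋆ 1_S)(x) μ(I x) = q^{ℓ(w)} μ(I x ∩ w S)`, because `|IwI / I| = q^{ℓ(w)}`. The series for
`t_1 ⋆ 1_S` is thus a multiple of the alternating sum of the `μ(I x ∩ w S)`. A set
`{x | x 0 * x 1 ∈ A}` is stable under `W̃` when `-A = A`; up to a coordinate axis, it is tiled by
its level sets for the valuation of `x 0`, and also by those for the valuation of `x 1`. The orbit
`S` is such a level set: the translates `w S` with `ℓ(w)` even form one of these tilings and those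
with `ℓ(w)` odd the other, so that the two halves of the series cancel.
-/

open MeasureTheory Filter
open scoped Topology Pointwise

noncomputable section

namespace AffineSL2

/-! ## Reduced words -/

/-- The product `s_i s_{1-i} s_i ⋯` of the alternating word with `n` letters and first letter `i`.
Every element of the affine Weyl group is of this form, uniquely except that `altProd 0 0` and
`altProd 1 0` are both `1`. -/
def altProd (i : Fin 2) (n : ℕ) : W := wordProd (altWord i n)

theorem altProd_zero (i : Fin 2) : altProd i 0 = 1 := rfl

theorem altProd_succ (i : Fin 2) (n : ℕ) : altProd i (n + 1) = s i * altProd (1 - i) n :=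
  wordProd_cons i _

theorem altProd_one (i : Fin 2) : altProd i 1 = s i := by
  rw [altProd_succ, altProd_zero, mul_one]

theorem s_mul_self (i : Fin 2) : s i * s i = 1 := by
  fin_cases i <;> rfl

theorem s_mul_altProd_succ (i : Fin 2) (n : ℕ) :
    s i * altProd i (n + 1) = altProd (1 - i) n := by
  rw [altProd_succ, ← mul_assoc, s_mul_self, one_mul]

theorem eq_or_eq_one_sub (i k : Fin 2) : k = i ∨ k = 1 - i := by
  revert i k; decide

theorem ne_one_sub (i : Fin 2) : i ≠ 1 - i := by
  revert i; decide

theorem exists_eq_altProd (w : W) : ∃ i n, w = altProd i n := by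
  have hw := wordProd_reducedWord w
  rcases w with n | n
  all_goals
    simp only [reducedWord] at hw
    split_ifs at hw <;> exact ⟨_, _, hw.symm⟩

theorem eq_altProd_one_sub_or_eq_altProd_succ (i : Fin 2) (w : W) :
    (∃ n, w = altProd (1 - i) n) ∨ ∃ n, w = altProd i (n + 1) := by
  obtain ⟨k, n, rfl⟩ := exists_eq_altProd w
  rcases eq_or_eq_one_sub i k with rfl | rfl
  · rcases n with _ | n
    · exact Or.inl ⟨0, rfl⟩
    · exact Or.inr ⟨n, rfl⟩
  · exact Or.inl ⟨n, rfl⟩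

theorem reducedWord_altProd (i : Fin 2) (n : ℕ) : reducedWord (altProd i n) = altWord i n := by
  obtain ⟨m, rfl | rfl⟩ := n.even_or_odd' <;> fin_cases i <;>
    simp only [Fin.zero_eta, Fin.mk_one, altProd, wordProd_altWord, reducedWord]
  · rw [if_pos (by omega), Int.natAbs_natCast]
  · rcases m with _ | m
    · rfl
    · rw [if_neg (by omega), Int.natAbs_neg, Int.natAbs_natCast]
  · rw [if_pos (by omega)]
    congr 1
    omega
  · rw [if_neg (by omega)]
    congr 1
    omega

theorem length_altProd (i : Fin 2) (n : ℕ) : length (altProd i n) = n := by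
  rw [← length_reducedWord, reducedWord_altProd, length_altWord]

theorem length_one : length 1 = 0 := length_altProd 0 0

theorem altProd_inj {i k : Fin 2} {n m : ℕ} :
    altProd i n = altProd k m ↔ n = m ∧ (n = 0 ∨ i = k) := by
  constructor
  · intro heq
    obtain rfl : n = m := by rw [← length_altProd i n, heq, length_altProd]
    have hword := congrArg reducedWord heq
    rw [reducedWord_altProd, reducedWord_altProd] at hword
    rcases n with _ | n
    · exact ⟨rfl, Or.inl rfl⟩
    · exact ⟨rfl, Or.inr (List.cons.inj hword).1⟩
  · rintro ⟨rfl, rfl | rfl⟩ <;> rfl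

theorem altProd_succ_ne_one (i : Fin 2) (n : ℕ) : altProd i (n + 1) ≠ 1 :=
  fun heq => absurd (altProd_inj.mp (heq.trans (altProd_zero i).symm)).1 n.succ_ne_zero

theorem altWord_sublist (i : Fin 2) {m n : ℕ} (hmn : m ≤ n) :
    (altWord i m).Sublist (altWord i n) := by
  induction n generalizing i m with
  | zero => rw [Nat.le_zero.mp hmn]
  | succ n ih =>
    rcases m with _ | m
    · exact List.nil_sublist _
    · exact (ih (1 - i) (Nat.le_of_succ_le_succ hmn)).cons_cons i

theorem mem_bruhatIic_iff {y w : W} : y ∈ bruhatIic w ↔ y = w ∨ length y < length w := by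
  constructor
  · exact fun hy => or_iff_not_imp_left.mpr (length_lt_of_mem_bruhatIic hy)
  rintro (rfl | hlt)
  · exact self_mem_bruhatIic _
  obtain ⟨i, n, rfl⟩ := exists_eq_altProd w
  obtain ⟨k, m, rfl⟩ := exists_eq_altProd y
  rw [length_altProd, length_altProd] at hlt
  suffices hsub : (altWord k m).Sublist (altWord i n) by
    simp only [bruhatIic, List.mem_toFinset, List.mem_map, List.mem_sublists, reducedWord_altProd]
    exact ⟨_, hsub, rfl⟩
  rcases eq_or_eq_one_sub i k with rfl | rfl
  · exact altWord_sublist _ hlt.le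
  · obtain ⟨n, rfl⟩ := Nat.exists_eq_add_of_lt hlt
    exact (altWord_sublist _ (Nat.le_add_right m n)).trans (List.sublist_cons_self _ _)

/-- The elements of length `n` of the affine Weyl group. -/
def lengthSphere (n : ℕ) : Finset W := {altProd 0 n, altProd 1 n}

theorem mem_lengthSphere {n : ℕ} {w : W} : w ∈ lengthSphere n ↔ length w = n := by
  obtain ⟨i, m, rfl⟩ := exists_eq_altProd w
  simp only [lengthSphere, Finset.mem_insert, Finset.mem_singleton, altProd_inj, length_altProd]
  fin_cases i <;> simp +contextual

theorem card_lengthSphere (n : ℕ) : (lengthSphere n).card = if n = 0 then 1 else 2 := by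
  split_ifs with hn
  · rw [hn, lengthSphere, altProd_zero, altProd_zero, Finset.pair_eq_singleton,
      Finset.card_singleton]
  · exact Finset.card_pair fun heq => by simpa [hn] using (altProd_inj.mp heq).2

theorem card_filter_lengthSphere_length_add (w : W) (n : ℕ) :
    {x ∈ lengthSphere (length w + n) | w ∈ bruhatIic x}.card = if n = 0 then 1 else 2 := by
  split_ifs with hn
  · refine Finset.card_eq_one.mpr ⟨w, ?_⟩
    ext x
    simp only [Finset.mem_filter, mem_lengthSphere, mem_bruhatIic_iff, Finset.mem_singleton]
    constructor
    · rintro ⟨hx, rfl | hlt⟩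
      · rfl
      · omega
    · rintro rfl
      exact ⟨by omega, Or.inl rfl⟩
  · rw [Finset.filter_true_of_mem, card_lengthSphere, if_neg (by omega)]
    intro x hx
    rw [mem_lengthSphere] at hx
    exact mem_bruhatIic_iff.mpr (Or.inr (by omega))

theorem filter_lengthSphere_eq_empty {w : W} {n : ℕ} (hn : n < length w) :
    {x ∈ lengthSphere n | w ∈ bruhatIic x} = ∅ := by
  refine Finset.filter_eq_empty_iff.mpr fun x hx hw => ?_
  rw [mem_lengthSphere] at hx
  rcases mem_bruhatIic_iff.mp hw with rfl | hlt <;> omega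

/-! ## Left multiplication in the Hecke algebra -/

theorem v_zero : v 0 = 1 := LaurentPolynomial.T_zero

theorem v_mul_v (k l : ℤ) : v k * v l = v (k + l) := (LaurentPolynomial.T_add k l).symm

theorem linearMap_ext_T {M : Type*} [AddCommMonoid M] [Module A M] {f f' : H →ₗ[A] M}
    (hf : ∀ w, f (T w) = f' (T w)) : f = f' := by
  ext w
  exact hf w

theorem T_apply_altProd (i k : Fin 2) (n m : ℕ) :
    T (altProd i n) (altProd k m) = if n = m ∧ (n = 0 ∨ i = k) then 1 else 0 := by
  rw [T, Finsupp.single_apply]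
  simp only [altProd_inj]

theorem mulGen_T (i : Fin 2) (w : W) : mulGen i (T w) =
    if length w < length (s i * w) then T (s i * w)
    else (v 2 - 1) • T w + v 2 • T (s i * w) :=
  (Finsupp.linearCombination_single A _ _).trans (one_smul _ _)

theorem mulGen_T_altProd_one_sub (i : Fin 2) (n : ℕ) :
    mulGen i (T (altProd (1 - i) n)) = T (altProd i (n + 1)) := by
  rw [mulGen_T, ← altProd_succ, length_altProd, length_altProd, if_pos n.lt_succ_self]

theorem mulGen_T_altProd_succ (i : Fin 2) (n : ℕ) : mulGen i (T (altProd i (n + 1))) =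
    (v 2 - 1) • T (altProd i (n + 1)) + v 2 • T (altProd (1 - i) n) := by
  rw [mulGen_T, s_mul_altProd_succ, length_altProd, length_altProd, if_neg (by omega)]

theorem mulGen_mulGen (i : Fin 2) (x : H) :
    mulGen i (mulGen i x) = (v 2 - 1) • mulGen i x + v 2 • x := by
  suffices hs : mulGen i ∘ₗ mulGen i = (v 2 - 1) • mulGen i + v 2 • LinearMap.id from
    LinearMap.congr_fun hs x
  refine linearMap_ext_T fun w => ?_
  simp only [LinearMap.comp_apply, LinearMap.add_apply, LinearMap.smul_apply, LinearMap.id_apply]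
  rcases eq_altProd_one_sub_or_eq_altProd_succ i w with ⟨n, rfl⟩ | ⟨n, rfl⟩
  · rw [mulGen_T_altProd_one_sub, mulGen_T_altProd_succ]
  · rw [mulGen_T_altProd_succ, map_add, map_smul, map_smul, mulGen_T_altProd_one_sub,
      mulGen_T_altProd_succ]

theorem mulGen_apply_altProd_one_sub (i : Fin 2) (x : H) (m : ℕ) :
    mulGen i x (altProd (1 - i) m) = v 2 * x (altProd i (m + 1)) := by
  suffices hs : Finsupp.lapply (altProd (1 - i) m) ∘ₗ mulGen i =
      v 2 • Finsupp.lapply (altProd i (m + 1)) from LinearMap.congr_fun hs x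
  refine linearMap_ext_T fun w => ?_
  simp only [LinearMap.comp_apply, LinearMap.smul_apply, Finsupp.lapply_apply, smul_eq_mul]
  have hi := ne_one_sub i
  rcases eq_altProd_one_sub_or_eq_altProd_succ i w with ⟨n, rfl⟩ | ⟨n, rfl⟩
  · simp +contextual [mulGen_T_altProd_one_sub, T_apply_altProd, hi, hi.symm]
  · by_cases hn : n = m <;>
      simp +contextual [mulGen_T_altProd_succ, T_apply_altProd, hi, hn]

theorem mulGen_apply_altProd_succ (i : Fin 2) (x : H) (m : ℕ) :
    mulGen i x (altProd i (m + 1)) =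
      x (altProd (1 - i) m) + (v 2 - 1) * x (altProd i (m + 1)) := by
  suffices hs : Finsupp.lapply (altProd i (m + 1)) ∘ₗ mulGen i =
      Finsupp.lapply (altProd (1 - i) m) + (v 2 - 1) • Finsupp.lapply (altProd i (m + 1)) from
    LinearMap.congr_fun hs x
  refine linearMap_ext_T fun w => ?_
  simp only [LinearMap.comp_apply, LinearMap.add_apply, LinearMap.smul_apply,
    Finsupp.lapply_apply, smul_eq_mul]
  have hi := ne_one_sub i
  rcases eq_altProd_one_sub_or_eq_altProd_succ i w with ⟨n, rfl⟩ | ⟨n, rfl⟩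
  · simp +contextual [mulGen_T_altProd_one_sub, T_apply_altProd, hi.symm]
  · by_cases hn : n = m <;>
      simp +contextual [mulGen_T_altProd_succ, T_apply_altProd, hi, hi.symm, hn]

/-- The multiplication `mul` of the Hecke algebra, as a linear map into its endomorphisms. -/
def leftMul : H →ₗ[A] Module.End A H := Finsupp.linearCombination A mulT

theorem mul_eq_leftMul (x y : H) : mul x y = leftMul x y := by
  rw [mul, leftMul, Finsupp.linearCombination_apply, Finsupp.sum, Finsupp.sum,
    LinearMap.sum_apply]
  rfl

theorem leftMul_T (w : W) : leftMul (T w) = mulT w := by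
  rw [leftMul, T, Finsupp.linearCombination_single, one_smul]

theorem mulT_one : mulT 1 = 1 := by
  rw [← altProd_zero 0, mulT, reducedWord_altProd]
  rfl

theorem mulT_altProd_succ (i : Fin 2) (n : ℕ) :
    mulT (altProd i (n + 1)) = mulGen i * mulT (altProd (1 - i) n) := by
  rw [mulT, reducedWord_altProd, mulT, reducedWord_altProd, altWord, List.map_cons,
    List.prod_cons]

theorem leftMul_mulGen (i : Fin 2) (x y : H) :
    leftMul (mulGen i x) y = mulGen i (leftMul x y) := by
  suffices hs : leftMul.flip y ∘ₗ mulGen i = mulGen i ∘ₗ leftMul.flip y from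
    LinearMap.congr_fun hs x
  refine linearMap_ext_T fun w => ?_
  simp only [LinearMap.comp_apply, LinearMap.flip_apply]
  rcases eq_altProd_one_sub_or_eq_altProd_succ i w with ⟨n, rfl⟩ | ⟨n, rfl⟩
  · rw [mulGen_T_altProd_one_sub, leftMul_T, mulT_altProd_succ, leftMul_T, Module.End.mul_apply]
  · rw [mulGen_T_altProd_succ, map_add, map_smul, map_smul, LinearMap.add_apply,
      LinearMap.smul_apply, LinearMap.smul_apply, leftMul_T, leftMul_T, mulT_altProd_succ,
      Module.End.mul_apply, mulGen_mulGen]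

theorem mulT_T_one (w : W) : mulT w (T 1) = T w := by
  obtain ⟨i, n, rfl⟩ := exists_eq_altProd w
  induction n generalizing i with
  | zero => rw [altProd_zero, mulT_one, Module.End.one_apply]
  | succ n ih => rw [mulT_altProd_succ, Module.End.mul_apply, ih, mulGen_T_altProd_one_sub]

theorem leftMul_T_one_right (x : H) : leftMul x (T 1) = x := by
  suffices hs : leftMul.flip (T 1) = LinearMap.id from LinearMap.congr_fun hs x
  refine linearMap_ext_T fun w => ?_
  rw [LinearMap.flip_apply, leftMul_T, mulT_T_one, LinearMap.id_apply]

/-! ## Multiplication by the Kazhdan-Lusztig elements of the simple reflections -/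

theorem hecke_ext {x y : H} (i : Fin 2)
    (hother : ∀ m, x (altProd (1 - i) m) = y (altProd (1 - i) m))
    (hsame : ∀ m, x (altProd i (m + 1)) = y (altProd i (m + 1))) : x = y := by
  ext1 w
  rcases eq_altProd_one_sub_or_eq_altProd_succ i w with ⟨n, rfl⟩ | ⟨n, rfl⟩
  · exact hother n
  · exact hsame n

/-- The Kazhdan-Lusztig element `C_w` of `w = altProd i n`, except that `altC i 0 = 0`. With this
convention `C_{s_i} C_{altProd (1 - i) n} = altC i (n + 1) + altC i (n - 1)` for all `n > 0`. -/
def altC (i : Fin 2) : ℕ → H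
  | 0 => 0
  | n + 1 => C (altProd i (n + 1))

theorem altC_zero (i : Fin 2) : altC i 0 = 0 := rfl

theorem altC_succ (i : Fin 2) (n : ℕ) : altC i (n + 1) = C (altProd i (n + 1)) := rfl

theorem altC_one (i : Fin 2) : altC i 1 = C (s i) := by
  rw [altC_succ, altProd_one]

theorem C_altProd_apply_altProd (i k : Fin 2) (n m : ℕ) : C (altProd i n) (altProd k m) =
    if m < n ∨ m = n ∧ (n = 0 ∨ i = k) then (-1) ^ (n + m) * v (n - 2 * m) else 0 := by
  simp only [C_apply, mem_bruhatIic_iff, length_altProd, altProd_inj, pow_add, mul_assoc]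
  exact if_congr (by grind) rfl rfl

theorem C_one : C 1 = T 1 := by
  ext1 y
  obtain ⟨k, m, rfl⟩ := exists_eq_altProd y
  rw [← altProd_zero 0, C_altProd_apply_altProd, T_apply_altProd]
  rcases m with _ | m <;> simp

theorem altC_apply_altProd_of_ne {i k : Fin 2} (hik : i ≠ k) (n m : ℕ) :
    altC i n (altProd k m) = if m < n then (-1) ^ (n + m) * v (n - 2 * m) else 0 := by
  rcases n with _ | n
  · simp [altC]
  · rw [altC_succ, C_altProd_apply_altProd]
    exact if_congr (by grind) rfl rfl

theorem altC_succ_apply_altProd (i : Fin 2) (n m : ℕ) : altC i (n + 1) (altProd i m) =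
    if m < n + 2 then (-1) ^ (n + 1 + m) * v (n + 1 - 2 * m) else 0 := by
  rw [altC_succ, C_altProd_apply_altProd]
  push_cast
  exact if_congr (by grind) rfl rfl

theorem altC_apply_altProd_succ (i : Fin 2) (n m : ℕ) : altC i n (altProd i (m + 1)) =
    if m < n then (-1) ^ (n + (m + 1)) * v (n - 2 * (m + 1)) else 0 := by
  rcases n with _ | n
  · simp [altC]
  · rw [altC_succ_apply_altProd]
    push_cast
    exact if_congr (by omega) rfl rfl

/-- Left multiplication by the Kazhdan-Lusztig element `C_{s_i} = v⁻¹ T_{s_i} - v`. -/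
def mulC (i : Fin 2) : H →ₗ[A] H := v (-1) • mulGen i - v 1 • LinearMap.id

theorem mulC_apply (i : Fin 2) (x : H) : mulC i x = v (-1) • mulGen i x - v 1 • x := rfl

theorem mulC_apply_altProd_one_sub (i : Fin 2) (x : H) (m : ℕ) :
    mulC i x (altProd (1 - i) m) = v 1 * (x (altProd i (m + 1)) - x (altProd (1 - i) m)) := by
  rw [mulC_apply, Finsupp.sub_apply, Finsupp.smul_apply, Finsupp.smul_apply, smul_eq_mul,
    smul_eq_mul, mulGen_apply_altProd_one_sub]
  have hv : v (-1) * v 2 = v 1 := v_mul_v (-1) 2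
  linear_combination x (altProd i (m + 1)) * hv

theorem mulC_apply_altProd_succ (i : Fin 2) (x : H) (m : ℕ) :
    mulC i x (altProd i (m + 1)) = v (-1) * (x (altProd (1 - i) m) - x (altProd i (m + 1))) := by
  rw [mulC_apply, Finsupp.sub_apply, Finsupp.smul_apply, Finsupp.smul_apply, smul_eq_mul,
    smul_eq_mul, mulGen_apply_altProd_succ]
  have hv : v (-1) * v 2 = v 1 := v_mul_v (-1) 2
  linear_combination x (altProd i (m + 1)) * hv

theorem mulC_C_one (i : Fin 2) : mulC i (C 1) = altC i 1 := by
  rw [C_one, mulC_apply, ← altProd_zero (1 - i), mulGen_T_altProd_one_sub]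
  refine hecke_ext i (fun m => ?_) (fun m => ?_)
  · rw [altC_apply_altProd_of_ne (ne_one_sub i)]
    rcases m with _ | m <;> simp [T_apply_altProd, ne_one_sub]
  · rw [altC_apply_altProd_succ]
    rcases m with _ | m <;> simp [T_apply_altProd]

theorem mulC_altC_self (i : Fin 2) (n : ℕ) :
    mulC i (altC i n) = -((v 1 + v (-1)) • altC i n) := by
  have hshift (m : ℕ) : v (-1) * v (n - 2 * m) = v 1 * v (n - 2 * (m + 1)) := by
    rw [v_mul_v, v_mul_v]
    ring_nf
  refine hecke_ext i (fun m => ?_) (fun m => ?_)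
  · rw [mulC_apply_altProd_one_sub, Finsupp.neg_apply, Finsupp.smul_apply, smul_eq_mul,
      altC_apply_altProd_of_ne (ne_one_sub i), altC_apply_altProd_succ]
    split_ifs
    · linear_combination (-1) ^ (n + m) * hshift m
    · ring
  · rw [mulC_apply_altProd_succ, Finsupp.neg_apply, Finsupp.smul_apply, smul_eq_mul,
      altC_apply_altProd_of_ne (ne_one_sub i), altC_apply_altProd_succ]
    split_ifs
    · linear_combination (-1) ^ (n + m) * hshift m
    · ring

theorem mulC_altC_one_sub (i : Fin 2) (n : ℕ) :
    mulC i (altC (1 - i) (n + 1)) = altC i (n + 2) + altC i n := by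
  have hne := ne_one_sub i
  refine hecke_ext i (fun m => ?_) (fun m => ?_)
  · rw [mulC_apply_altProd_one_sub, Finsupp.add_apply, altC_apply_altProd_of_ne hne.symm,
      altC_succ_apply_altProd, altC_apply_altProd_of_ne hne, altC_apply_altProd_of_ne hne]
    have hlow : v 1 * v (n + 1 - 2 * (m + 1)) = v (n - 2 * m) := by
      rw [v_mul_v]
      ring_nf
    have hhigh : v 1 * v (n + 1 - 2 * m) = v (n + 2 - 2 * m) := by
      rw [v_mul_v]
      ring_nf
    push_cast
    rw [← hlow, ← hhigh]
    split_ifs <;> first | omega | ring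
  · rw [mulC_apply_altProd_succ, Finsupp.add_apply, altC_apply_altProd_of_ne hne.symm,
      altC_succ_apply_altProd, altC_apply_altProd_succ, altC_apply_altProd_succ]
    have hlow : v (-1) * v (n + 1 - 2 * (m + 1)) = v (n - 2 * (m + 1)) := by
      rw [v_mul_v]
      ring_nf
    have hhigh : v (-1) * v (n + 1 - 2 * m) = v (n + 2 - 2 * (m + 1)) := by
      rw [v_mul_v]
      ring_nf
    push_cast
    rw [← hlow, ← hhigh]
    split_ifs <;> first | omega | ring

theorem leftMul_mulC (i : Fin 2) (x y : H) : leftMul (mulC i x) y = mulC i (leftMul x y) := by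
  rw [mulC_apply, mulC_apply, map_sub, map_smul, map_smul, LinearMap.sub_apply,
    LinearMap.smul_apply, LinearMap.smul_apply, leftMul_mulGen]

theorem leftMul_C_one (x : H) : leftMul (C 1) x = x := by
  rw [C_one, leftMul_T, mulT_one, Module.End.one_apply]

theorem leftMul_altC_one (i : Fin 2) (x : H) : leftMul (altC i 1) x = mulC i x := by
  rw [← mulC_C_one, leftMul_mulC, leftMul_C_one]

theorem leftMul_altC_add_two (i : Fin 2) (n : ℕ) (x : H) : leftMul (altC i (n + 2)) x =
    mulC i (leftMul (altC (1 - i) (n + 1)) x) - leftMul (altC i n) x := by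
  rw [← leftMul_mulC, mulC_altC_one_sub, map_add, LinearMap.add_apply, add_sub_cancel_right]

/-! ## Structure constants and the `a`-function -/

theorem h_eq (x y z : W) : h x y z = basisC.repr (leftMul (C x) (C y)) z := by
  rw [h, mul_eq_leftMul]

theorem basisC_apply (w : W) : basisC w = C w := Module.Basis.mk_apply _ _ _

theorem repr_C (w z : W) : basisC.repr (C w) z = if w = z then 1 else 0 := by
  rw [← basisC_apply, Module.Basis.repr_self, Finsupp.single_apply]

theorem repr_altC_altProd_succ (i k : Fin 2) (n m : ℕ) :
    basisC.repr (altC i n) (altProd k (m + 1)) = if n = m + 1 ∧ i = k then 1 else 0 := by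
  rcases n with _ | n
  · simp [altC]
  · simp [altC, repr_C, altProd_inj]

theorem repr_altC_one (i : Fin 2) (n : ℕ) : basisC.repr (altC i n) 1 = 0 := by
  rcases n with _ | n
  · simp [altC]
  · rw [altC_succ, repr_C, if_neg (altProd_succ_ne_one i n)]

/-- The subring `ℤ[v]` of `𝒜 = ℤ[v, v⁻¹]`. -/
def polySubring : Subring A := (Polynomial.toLaurent (R := ℤ)).range

theorem v_natCast_mem_polySubring (n : ℕ) : v n ∈ polySubring :=
  ⟨_, Polynomial.toLaurent_X_pow n⟩

/-- The lattice `v⁻¹ ∑ ℤ[v] C_w` in the right cell module spanned by the `C_w` for which `w ≠ 1`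
has a reduced word with first letter `i`. -/
def cellLattice (i : Fin 2) : Submodule polySubring H :=
  Submodule.span polySubring (Set.range fun n => v (-1) • altC i n)

theorem smul_altC_mem_cellLattice (i : Fin 2) (n : ℕ) {p : A} (hp : v 1 * p ∈ polySubring) :
    p • altC i n ∈ cellLattice i := by
  have hmem := (cellLattice i).smul_mem ⟨_, hp⟩ (Submodule.subset_span ⟨n, rfl⟩)
  rwa [Subring.smul_def, smul_smul, mul_right_comm, v_mul_v, add_neg_cancel,
    v_zero, one_mul] at hmem

theorem altC_mem_cellLattice (i : Fin 2) (n : ℕ) : altC i n ∈ cellLattice i := by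
  rw [← one_smul A (altC i n)]
  refine smul_altC_mem_cellLattice i n ?_
  rw [mul_one]
  exact v_natCast_mem_polySubring 1

theorem mulC_mem_cellLattice {i : Fin 2} {x : H} (hx : x ∈ cellLattice (1 - i)) :
    mulC i x ∈ cellLattice i := by
  induction hx using Submodule.span_induction with
  | mem x hx =>
    obtain ⟨_ | n, rfl⟩ := hx
    · simp [altC]
    · rw [map_smul, mulC_altC_one_sub, smul_add]
      exact add_mem (Submodule.subset_span ⟨_, rfl⟩) (Submodule.subset_span ⟨_, rfl⟩)
  | zero => simp
  | add x y _ _ hx hy =>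
    rw [map_add]
    exact add_mem hx hy
  | smul p x _ hx =>
    rw [Subring.smul_def, map_smul]
    exact Submodule.smul_mem _ p hx

theorem mulC_altC_mem_cellLattice (i k : Fin 2) (n : ℕ) : mulC i (altC k n) ∈ cellLattice i := by
  rcases eq_or_eq_one_sub i k with rfl | rfl
  · rw [mulC_altC_self]
    refine neg_mem (smul_altC_mem_cellLattice _ _ ?_)
    rw [mul_add, v_mul_v, v_mul_v]
    exact add_mem (v_natCast_mem_polySubring 2) (v_natCast_mem_polySubring 0)
  · exact mulC_mem_cellLattice (altC_mem_cellLattice _ _)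

theorem leftMul_altC_mem_cellLattice (i : Fin 2) (n : ℕ) (y : W) :
    leftMul (altC i n) (C y) ∈ cellLattice i := by
  induction n using Nat.twoStepInduction generalizing i with
  | zero => simp [altC]
  | one =>
    obtain ⟨k, m, rfl⟩ := exists_eq_altProd y
    rw [leftMul_altC_one]
    rcases m with _ | m
    · rw [altProd_zero, mulC_C_one]
      exact altC_mem_cellLattice _ _
    · exact mulC_altC_mem_cellLattice i k (m + 1)
  | more n ih₀ ih₁ =>
    rw [leftMul_altC_add_two]
    exact sub_mem (mulC_mem_cellLattice (ih₁ _)) (ih₀ _)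

theorem repr_one_eq_zero_of_mem_cellLattice {i : Fin 2} {x : H} (hx : x ∈ cellLattice i) :
    basisC.repr x 1 = 0 := by
  induction hx using Submodule.span_induction with
  | mem x hx =>
    obtain ⟨n, rfl⟩ := hx
    rw [map_smul, Finsupp.smul_apply, repr_altC_one, smul_zero]
  | zero => simp
  | add x y _ _ hx hy => rw [map_add, Finsupp.add_apply, hx, hy, add_zero]
  | smul p x _ hx => rw [Subring.smul_def, map_smul, Finsupp.smul_apply, hx, smul_zero]

theorem v_mul_repr_mem_polySubring {i : Fin 2} {x : H} (hx : x ∈ cellLattice i) (z : W) :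
    v 1 * basisC.repr x z ∈ polySubring := by
  induction hx using Submodule.span_induction with
  | mem x hx =>
    obtain ⟨n, rfl⟩ := hx
    rcases n with _ | n
    · simp [altC]
    · rw [map_smul, Finsupp.smul_apply, altC_succ, repr_C, smul_eq_mul, ← mul_assoc, v_mul_v,
        add_neg_cancel, v_zero, one_mul]
      split_ifs
      · exact one_mem _
      · exact zero_mem _
  | zero => simp
  | add x y _ _ hx hy =>
    rw [map_add, Finsupp.add_apply, mul_add]
    exact add_mem hx hy
  | smul p x _ hx =>
    rw [Subring.smul_def, map_smul, Finsupp.smul_apply, smul_eq_mul, mul_left_comm]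
    exact mul_mem p.2 hx

theorem h_one_left (y z : W) : h 1 y z = if y = z then 1 else 0 := by
  rw [h_eq, leftMul_C_one, repr_C]

theorem h_one_right (x z : W) : h x 1 z = if x = z then 1 else 0 := by
  rw [h_eq, C_one, leftMul_T_one_right, repr_C]

theorem h_to_one (x y : W) : h x y 1 = if x = 1 ∧ y = 1 then 1 else 0 := by
  obtain ⟨i, n, rfl⟩ := exists_eq_altProd x
  rcases n with _ | n
  · simp [altProd_zero, h_one_left]
  · rw [if_neg fun hx => altProd_succ_ne_one i n hx.1, h_eq]
    exact repr_one_eq_zero_of_mem_cellLattice (leftMul_altC_mem_cellLattice i (n + 1) y)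

theorem v_mul_h_mem_polySubring (x y z : W) : v 1 * h x y z ∈ polySubring := by
  obtain ⟨i, n, rfl⟩ := exists_eq_altProd x
  rcases n with _ | n
  · rw [altProd_zero, h_one_left, mul_ite, mul_one, mul_zero]
    split_ifs
    · exact v_natCast_mem_polySubring 1
    · exact zero_mem _
  · rw [h_eq]
    exact v_mul_repr_mem_polySubring (leftMul_altC_mem_cellLattice i (n + 1) y) z

theorem h_s_altProd_succ_self (i : Fin 2) (n : ℕ) :
    h (s i) (altProd i (n + 1)) (altProd i (n + 1)) = -(v 1 + v (-1)) := by
  rw [h_eq, ← altC_one, ← altC_succ, leftMul_altC_one, mulC_altC_self, map_neg, map_smul,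
    Finsupp.neg_apply, Finsupp.smul_apply, repr_altC_altProd_succ, if_pos ⟨rfl, rfl⟩, smul_eq_mul,
    mul_one]

theorem coeff_neg_one_eq_zero_of_mem_polySubring {p : A} (hp : p ∈ polySubring) :
    p.coeff (-1) = 0 := by
  obtain ⟨p, rfl⟩ := hp
  rw [← Finsupp.notMem_support_iff, LaurentPolynomial.support_coeff_toLaurent]
  simp

theorem a_one : a 1 = 0 := by
  refine Nat.le_zero.mp (Nat.sInf_le fun x y => ?_)
  change _ ∈ polySubring
  rw [pow_zero, one_mul, h_to_one]
  split_ifs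
  · exact one_mem _
  · exact zero_mem _

theorem a_altProd_succ (i : Fin 2) (n : ℕ) : a (altProd i (n + 1)) = 1 := by
  have hmem (x y : W) : (-v 1) ^ 1 * h x y (altProd i (n + 1)) ∈ polySubring := by
    rw [pow_one, neg_mul]
    exact neg_mem (v_mul_h_mem_polySubring x y _)
  refine le_antisymm (Nat.sInf_le hmem) (Nat.one_le_iff_ne_zero.mpr fun hzero => ?_)
  obtain hmem' | hempty := Nat.sInf_eq_zero.mp hzero
  · have hpoly : h (s i) (altProd i (n + 1)) (altProd i (n + 1)) ∈ polySubring := by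
      have hrange := hmem' (s i) (altProd i (n + 1))
      rwa [pow_zero, one_mul] at hrange
    rw [h_s_altProd_succ_self] at hpoly
    simpa [v] using coeff_neg_one_eq_zero_of_mem_polySubring hpoly
  · exact hempty.le hmem

/-! ## Lusztig's map `φ` in coordinates -/

theorem leftMul_altC_add (i : Fin 2) (n : ℕ) : leftMul (altC i (n + 1)) (altC 0 1 + altC 1 1) =
    altC i (n + 2) + altC i n - (v 1 + v (-1)) • altC i (n + 1) := by
  have hsum (i : Fin 2) : altC 0 1 + altC 1 1 = altC i 1 + altC (1 - i) 1 := by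
    fin_cases i
    · rfl
    · exact add_comm _ _
  have hone (i : Fin 2) : leftMul (altC i 1) (altC 0 1 + altC 1 1) =
      altC i 2 - (v 1 + v (-1)) • altC i 1 := by
    rw [hsum i, leftMul_altC_one, map_add, mulC_altC_self, mulC_altC_one_sub, altC_zero]
    module
  induction n using Nat.twoStepInduction generalizing i with
  | zero => rw [hone, altC_zero, add_zero]
  | one =>
    rw [leftMul_altC_add_two, hone, map_sub, map_smul, mulC_altC_one_sub, mulC_altC_one_sub,
      altC_zero, map_zero, LinearMap.zero_apply]
    module
  | more n ih₀ ih₁ =>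
    rw [leftMul_altC_add_two, ih₁, ih₀, map_sub, map_add, map_smul, mulC_altC_one_sub,
      mulC_altC_one_sub, mulC_altC_one_sub]
    module

theorem h_s_zero_add_h_s_one (x : W) (k : Fin 2) (m : ℕ) :
    h x (s 0) (altProd k (m + 1)) + h x (s 1) (altProd k (m + 1)) =
      (if x = altProd k m then 1 else 0) + (if x = altProd k (m + 2) then 1 else 0) -
        if x = altProd k (m + 1) then v 1 + v (-1) else 0 := by
  rw [h_eq, h_eq, ← Finsupp.add_apply, ← map_add, ← map_add, ← altC_one, ← altC_one]
  obtain ⟨i, n, rfl⟩ := exists_eq_altProd x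
  rcases n with _ | n
  · rw [altProd_zero, leftMul_C_one, map_add, Finsupp.add_apply, repr_altC_altProd_succ,
      repr_altC_altProd_succ, ← altProd_zero k]
    simp only [altProd_inj]
    fin_cases k <;> rcases m with _ | m <;> simp
  · rw [← altC_succ, leftMul_altC_add, map_sub, map_add, map_smul,
      Finsupp.sub_apply, Finsupp.add_apply, Finsupp.smul_apply, repr_altC_altProd_succ,
      repr_altC_altProd_succ, repr_altC_altProd_succ]
    simp [altProd_inj]

theorem a_s (i : Fin 2) : a (s i) = 1 := by
  rw [← altProd_one, a_altProd_succ]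

theorem filter_distinguished_a_eq_a_one : {d ∈ distinguished | a d = a 1} = {1} := by
  simp [distinguished, Finset.filter_insert, Finset.filter_singleton, a_s, a_one]

theorem filter_distinguished_a_eq_a_altProd_succ (k : Fin 2) (m : ℕ) :
    {d ∈ distinguished | a d = a (altProd k (m + 1))} = {s 0, s 1} := by
  simp [distinguished, Finset.filter_insert, Finset.filter_singleton, a_s, a_one, a_altProd_succ]

theorem toSeries_zero : toSeries 0 = 0 := by
  ext
  simp [toSeries]

theorem toSeries_add (p p' : A) : toSeries (p + p') = toSeries p + toSeries p' := by
  ext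
  simp [toSeries]

theorem toSeries_sub (p p' : A) : toSeries (p - p') = toSeries p - toSeries p' := by
  ext
  simp [toSeries]

theorem toSeries_v (n : ℤ) : toSeries (v n) = HahnSeries.single n 1 := by
  ext k
  simp [toSeries, HahnSeries.coeff_single, eq_comm]

theorem toSeries_one : toSeries 1 = 1 := by
  rw [← v_zero, toSeries_v, HahnSeries.single_zero_one]

theorem sum_phi_one (β : ℤ⸨X⸩) (x : W) :
    ∑ d ∈ distinguished with a d = a 1, β * toSeries (h x d 1) = if x = 1 then β else 0 := by
  rw [filter_distinguished_a_eq_a_one, Finset.sum_singleton, h_one_right, apply_ite toSeries,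
    toSeries_one, toSeries_zero, mul_ite, mul_one, mul_zero]

theorem sum_phi_altProd_succ (β : ℤ⸨X⸩) (x : W) (k : Fin 2) (m : ℕ) :
    ∑ d ∈ distinguished with a d = a (altProd k (m + 1)),
      β * toSeries (h x d (altProd k (m + 1))) =
    (if x = altProd k m then β else 0) + (if x = altProd k (m + 2) then β else 0) -
      if x = altProd k (m + 1) then β * (HahnSeries.single 1 1 + HahnSeries.single (-1) 1)
      else 0 := by
  have hs : s 0 ≠ s 1 := by decide
  rw [filter_distinguished_a_eq_a_altProd_succ, Finset.sum_pair hs, ← mul_add, ← toSeries_add,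
    h_s_zero_add_h_s_one]
  simp only [toSeries_sub, toSeries_add, apply_ite toSeries, toSeries_one, toSeries_zero,
    toSeries_v, mul_sub, mul_add, mul_ite, mul_one, mul_zero]

/-! ## Formal sums -/

theorem HasFormalSum.unique {f : W → ℤ⸨X⸩} {S S' : ℤ⸨X⸩} (hS : HasFormalSum f S)
    (hS' : HasFormalSum f S') : S = S' := by
  obtain ⟨F, hF, rfl⟩ := hS
  obtain ⟨F', hF', rfl⟩ := hS'
  rw [HahnSeries.SummableFamily.ext fun x => (hF x).trans (hF' x).symm]

theorem HasFormalSum.add {f f' : W → ℤ⸨X⸩} {S S' : ℤ⸨X⸩} (hS : HasFormalSum f S)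
    (hS' : HasFormalSum f' S') : HasFormalSum (fun x => f x + f' x) (S + S') := by
  obtain ⟨F, hF, rfl⟩ := hS
  obtain ⟨F', hF', rfl⟩ := hS'
  exact ⟨F + F', fun x => by rw [HahnSeries.SummableFamily.add_apply, hF, hF'],
    HahnSeries.SummableFamily.hsum_add⟩

theorem HasFormalSum.sub {f f' : W → ℤ⸨X⸩} {S S' : ℤ⸨X⸩} (hS : HasFormalSum f S)
    (hS' : HasFormalSum f' S') : HasFormalSum (fun x => f x - f' x) (S - S') := by
  obtain ⟨F, hF, rfl⟩ := hS
  obtain ⟨F', hF', rfl⟩ := hS'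
  exact ⟨F - F', fun x => by rw [HahnSeries.SummableFamily.sub_apply, hF, hF'],
    HahnSeries.SummableFamily.hsum_sub⟩

theorem hasFormalSum_ite_eq (y : W) (f : W → ℤ⸨X⸩) :
    HasFormalSum (fun x => if x = y then f x else 0) (f y) := by
  refine ⟨HahnSeries.SummableFamily.single y (f y), fun x => ?_,
    HahnSeries.SummableFamily.hsum_single _ _⟩
  rw [HahnSeries.SummableFamily.single_toFun, Pi.single_apply]
  exact ite_congr rfl (fun hx => by rw [hx]) fun _ => rfl

theorem hasFormalSum_phi_one (c : W → ℤ⸨X⸩) : HasFormalSum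
    (fun x => ∑ d ∈ distinguished with a d = a 1, c x * toSeries (h x d 1)) (c 1) := by
  simp only [sum_phi_one]
  exact hasFormalSum_ite_eq _ c

theorem hasFormalSum_phi_altProd_succ (c : W → ℤ⸨X⸩) (k : Fin 2) (m : ℕ) : HasFormalSum
    (fun x => ∑ d ∈ distinguished with a d = a (altProd k (m + 1)),
      c x * toSeries (h x d (altProd k (m + 1))))
    (c (altProd k m) + c (altProd k (m + 2)) -
      c (altProd k (m + 1)) * (HahnSeries.single 1 1 + HahnSeries.single (-1) 1)) := by
  simp only [sum_phi_altProd_succ]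
  exact ((hasFormalSum_ite_eq _ c).add (hasFormalSum_ite_eq _ c)).sub
    (hasFormalSum_ite_eq _ fun x => c x * (HahnSeries.single 1 1 + HahnSeries.single (-1) 1))

theorem isPhi_iff {c d : W → ℤ⸨X⸩} : IsPhi c d ↔ IsNull c ∧ IsNull d ∧ d 1 = c 1 ∧
    ∀ k m, d (altProd k (m + 1)) = c (altProd k m) + c (altProd k (m + 2)) -
      c (altProd k (m + 1)) * (HahnSeries.single 1 1 + HahnSeries.single (-1) 1) := by
  refine and_congr_right fun _ => and_congr_right fun _ => ⟨fun hsum => ?_, ?_⟩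
  · exact ⟨(hsum 1).unique (hasFormalSum_phi_one c),
      fun k m => (hsum _).unique (hasFormalSum_phi_altProd_succ c k m)⟩
  · rintro ⟨hone, hsucc⟩ z
    obtain ⟨k, _ | m, rfl⟩ := exists_eq_altProd z
    · rw [altProd_zero, hone]
      exact hasFormalSum_phi_one c
    · rw [hsucc]
      exact hasFormalSum_phi_altProd_succ c k m

theorem isNull_asympBasis (y : W) : IsNull (asympBasis y) := by
  refine fun _ => ⟨length y + 1, fun x hx n _ => ?_⟩
  have hxy : x ≠ y := by
    rintro rfl
    omega
  rw [asympBasis, Pi.single_eq_of_ne hxy, HahnSeries.coeff_zero]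

theorem isNull_single_length (u : W → ℤ) :
    IsNull fun x => HahnSeries.single (length x : ℤ) (u x) := by
  refine fun N => ⟨N, fun x hx n hn => ?_⟩
  rw [HahnSeries.coeff_single_of_ne]
  omega

theorem single_mul_single_one {R : Type*} [Semiring R] (k l : ℤ) :
    (HahnSeries.single k 1 * HahnSeries.single l 1 : R⸨X⸩) = HahnSeries.single (k + l) 1 := by
  rw [HahnSeries.single_mul_single, mul_one]

/- The defect `β (n + 1) - X β n` is multiplied by `X⁻¹` at each step, so it must vanish for `β` not
to acquire poles. -/
theorem eq_single_of_recurrence {R : Type*} [CommRing R] {β : ℕ → R⸨X⸩} (hzero : β 0 = 1)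
    (hrec : ∀ m, β m + β (m + 2) -
      β (m + 1) * (HahnSeries.single 1 1 + HahnSeries.single (-1) 1) = 0)
    (hpoles : ∃ L, ∀ n ≥ L, ∀ k : ℤ, k < 0 → (β n).coeff k = 0) (n : ℕ) :
    β n = HahnSeries.single (n : ℤ) 1 := by
  have hX : (HahnSeries.single 1 1 * HahnSeries.single (-1) 1 : R⸨X⸩) = 1 :=
    single_mul_single_one 1 (-1)
  obtain ⟨L, hL⟩ := hpoles
  set γ : ℕ → R⸨X⸩ := fun n => β (n + 1) - HahnSeries.single 1 1 * β n with hγ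
  have hγ_succ (n : ℕ) : γ (n + 1) = HahnSeries.single (-1) 1 * γ n := by
    linear_combination hrec n + β n * hX
  have hγ_eq (n : ℕ) : γ n = HahnSeries.single (-n : ℤ) 1 * γ 0 := by
    induction n with
    | zero => rw [Nat.cast_zero, neg_zero, HahnSeries.single_zero_one, one_mul]
    | succ n ih =>
      rw [hγ_succ, ih, ← mul_assoc, single_mul_single_one, Nat.cast_succ, neg_add_rev]
  have hγ_zero : γ 0 = 0 := by
    ext k
    have hcoeff : (γ (L + k.natAbs + 1)).coeff (k + -((L + k.natAbs + 1 : ℕ) : ℤ)) = 0 := by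
      rw [hγ, HahnSeries.coeff_sub, HahnSeries.coeff_single_mul, hL _ (by omega) _ (by omega),
        hL _ (by omega) _ (by omega), mul_zero, sub_zero]
    rw [hγ_eq, HahnSeries.coeff_single_mul_add, one_mul] at hcoeff
    rw [hcoeff, HahnSeries.coeff_zero]
  induction n with
  | zero => exact hzero
  | succ n ih =>
    have hstep : β (n + 1) - HahnSeries.single 1 1 * β n = 0 :=
      (hγ_eq n).trans (by rw [hγ_zero, mul_zero])
    rw [sub_eq_zero.mp hstep, ih, single_mul_single_one, Nat.cast_succ, add_comm]

theorem isPhi_asympBasis_one_iff {c : W → ℤ⸨X⸩} :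
    IsPhi c (asympBasis 1) ↔ c = fun x => HahnSeries.single (length x : ℤ) 1 := by
  have hone : asympBasis 1 1 = 1 := Pi.single_eq_same _ _
  have hsucc (k : Fin 2) (m : ℕ) : asympBasis 1 (altProd k (m + 1)) = 0 :=
    Pi.single_eq_of_ne (altProd_succ_ne_one k m) _
  simp only [isPhi_iff, isNull_asympBasis, hone, hsucc, true_and]
  constructor
  · rintro ⟨hnull, hc_one, hrec⟩
    funext x
    obtain ⟨k, n, rfl⟩ := exists_eq_altProd x
    rw [length_altProd]
    refine eq_single_of_recurrence (β := fun n => c (altProd k n)) hc_one.symm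
      (fun m => (hrec k m).symm) ?_ n
    obtain ⟨L, hL⟩ := hnull 0
    exact ⟨L, fun n hn => hL _ (by rwa [length_altProd])⟩
  · rintro rfl
    refine ⟨isNull_single_length _, ?_, fun k m => ?_⟩
    · simp only [length_one, Nat.cast_zero, HahnSeries.single_zero_one]
    · simp only [length_altProd, mul_add, single_mul_single_one]
      push_cast
      ring_nf

/-! ## The element `t₁` -/

/-- The embedding of `ℤ⟦q⁻¹⟧` into `ℤ((q^{-1/2}))`, which sends the variable `q⁻¹` to `X ^ 2`. -/
def ofQInv : PowerSeries ℤ →+* ℤ⸨X⸩ :=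
  (HahnSeries.embDomainRingHom (2 • Nat.castAddMonoidHom ℤ) (fun m n => by simp)
    fun m n => by simp).comp HahnSeries.toPowerSeries.symm.toRingHom

theorem coeff_ofQInv_two_mul (p : PowerSeries ℤ) (n : ℕ) :
    (ofQInv p).coeff (2 * n) = p.coeff n := by
  have hn : (2 * n : ℤ) = (2 • Nat.castAddMonoidHom ℤ) n := by simp
  rw [hn]
  exact HahnSeries.embDomain_mk_coeff _ _

theorem coeff_ofQInv_of_ne {k : ℤ} (hk : ∀ n : ℕ, k ≠ 2 * n) (p : PowerSeries ℤ) :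
    (ofQInv p).coeff k = 0 := by
  refine HahnSeries.embDomain_of_notMem_range ?_
  rintro ⟨n, hn⟩
  exact hk n (hn.symm.trans (nsmul_eq_mul 2 (n : ℤ)))

theorem ofQInv_monomial (n : ℕ) (r : ℤ) :
    ofQInv (PowerSeries.monomial n r) = HahnSeries.single (2 * n : ℤ) r := by
  ext k
  by_cases hk : ∃ m : ℕ, k = 2 * m
  · obtain ⟨m, rfl⟩ := hk
    rcases eq_or_ne m n with rfl | hmn
    · rw [coeff_ofQInv_two_mul, PowerSeries.coeff_monomial_same, HahnSeries.coeff_single_same]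
    · rw [coeff_ofQInv_two_mul, PowerSeries.coeff_monomial, if_neg hmn,
        HahnSeries.coeff_single_of_ne (by omega)]
  · push Not at hk
    rw [coeff_ofQInv_of_ne hk, HahnSeries.coeff_single_of_ne (hk n)]

theorem hasFormalSum_ofQInv_monomial_length (r : W → ℤ) :
    HasFormalSum (fun x => ofQInv (PowerSeries.monomial (length x) (r x)))
      (ofQInv (PowerSeries.mk fun n => ∑ x ∈ lengthSphere n, r x)) := by
  have hcoeff (x : W) (k : ℤ) (hx : (ofQInv (PowerSeries.monomial (length x) (r x))).coeff k ≠ 0) :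
      k = 2 * length x := by
    rw [ofQInv_monomial] at hx
    exact not_imp_comm.mp HahnSeries.coeff_single_of_ne hx
  refine ⟨⟨_, Set.IsWF.isPWO (BddBelow.wellFoundedOn_lt ⟨0, ?_⟩), fun k =>
    (lengthSphere (k / 2).toNat).finite_toSet.subset fun x hx => ?_⟩, fun x => rfl, ?_⟩
  · intro k hk
    obtain ⟨x, hx⟩ := Set.mem_iUnion.mp hk
    have := hcoeff x k hx
    omega
  · have := hcoeff x k hx
    exact mem_lengthSphere.mpr (by omega)
  · ext k
    rw [HahnSeries.SummableFamily.coeff_hsum]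
    by_cases hk : ∃ n : ℕ, k = 2 * n
    · obtain ⟨n, rfl⟩ := hk
      rw [coeff_ofQInv_two_mul, PowerSeries.coeff_mk]
      refine (finsum_eq_sum_of_support_subset _ fun x hx => ?_).trans
        (Finset.sum_congr rfl fun x hx => ?_)
      · have := hcoeff x _ hx
        exact mem_lengthSphere.mpr (by omega)
      · rw [← mem_lengthSphere.mp hx]
        exact (coeff_ofQInv_two_mul _ _).trans (PowerSeries.coeff_monomial_same _ _)
    · push Not at hk
      rw [coeff_ofQInv_of_ne hk]
      exact finsum_eq_zero_of_forall_eq_zero fun x => coeff_ofQInv_of_ne hk _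

/-- The power series `(1 - X) / (1 + X) = 1 + 2 ∑_{n > 0} (-X) ^ n`. Its `n`-th coefficient is, up
to sign, the number of elements of length `ℓ(w) + n` above `w` in the Bruhat order. -/
def cayleySeries : PowerSeries ℤ := PowerSeries.mk fun n => (-1) ^ n * if n = 0 then 1 else 2

theorem coeff_cayleySeries (n : ℕ) :
    cayleySeries.coeff n = (-1) ^ n * if n = 0 then 1 else 2 := PowerSeries.coeff_mk _ _

theorem cayleySeries_mul : cayleySeries * (1 + PowerSeries.X) = 1 - PowerSeries.X := by
  ext n
  rw [mul_add, mul_one, map_add, map_sub, coeff_cayleySeries]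
  rcases n with _ | _ | n
  · rw [PowerSeries.coeff_zero_mul_X, PowerSeries.coeff_zero_X, PowerSeries.coeff_zero_one]
    rfl
  · rw [PowerSeries.coeff_succ_mul_X, coeff_cayleySeries, PowerSeries.coeff_one_X,
      PowerSeries.coeff_one]
    rfl
  · rw [PowerSeries.coeff_succ_mul_X, coeff_cayleySeries, PowerSeries.coeff_X,
      PowerSeries.coeff_one, if_neg (by omega), if_neg (by omega), if_neg (by omega),
      if_neg (by omega), pow_succ]
    ring

theorem coeff_mul_neg_X_pow {R : Type*} [CommRing R] (p : PowerSeries R) (l n : ℕ) :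
    (p * (-PowerSeries.X) ^ l).coeff n = if l ≤ n then (-1) ^ l * p.coeff (n - l) else 0 := by
  rcases l.even_or_odd with hl | hl
  · rw [hl.neg_pow, hl.neg_one_pow, one_mul, PowerSeries.coeff_mul_X_pow']
  · rw [hl.neg_pow, hl.neg_one_pow, mul_neg, map_neg, neg_one_mul, PowerSeries.coeff_mul_X_pow']
    split_ifs <;> simp only [neg_zero]

theorem single_neg_one_pow (k : ℤ) (n : ℕ) :
    HahnSeries.single k ((-1) ^ n) = (-1) ^ n * (HahnSeries.single k 1 : ℤ⸨X⸩) := by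
  rcases n.even_or_odd with hn | hn
  · rw [hn.neg_one_pow, hn.neg_one_pow, one_mul]
  · rw [hn.neg_one_pow, hn.neg_one_pow, neg_one_mul, HahnSeries.single_neg]

/-- The scalar `(1 - q⁻¹) / (1 + q⁻¹)`, where `X = q^{-1/2}`. -/
def kappa : ℤ⸨X⸩ := ofQInv cayleySeries

theorem kappa_mul : kappa * (1 + HahnSeries.single 2 1) = 1 - HahnSeries.single 2 1 := by
  have hX : ofQInv PowerSeries.X = HahnSeries.single 2 1 := ofQInv_monomial 1 1
  rw [kappa, ← hX, ← map_one ofQInv, ← map_add, ← map_sub, ← map_mul, cayleySeries_mul]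

theorem g_eq_ofQInv (w : W) : g w = ofQInv ((-PowerSeries.X) ^ length w) := by
  rw [neg_pow, map_mul, map_pow, map_neg, map_one, PowerSeries.X_pow_eq, ofQInv_monomial, g]

theorem kappa_mul_g (w : W) :
    kappa * g w = ofQInv (cayleySeries * (-PowerSeries.X) ^ length w) := by
  rw [kappa, g_eq_ofQInv, map_mul]

theorem sum_lengthSphere_neg_one_pow_length (w : W) (n : ℕ) :
    ∑ x ∈ lengthSphere n, (if w ∈ bruhatIic x then (-1) ^ length x else 0) =
      (cayleySeries * (-PowerSeries.X) ^ length w).coeff n := by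
  rw [← Finset.sum_filter, Finset.sum_congr rfl fun x hx => by
    rw [mem_lengthSphere.mp (Finset.mem_filter.mp hx).1], Finset.sum_const, coeff_mul_neg_X_pow]
  rcases lt_or_ge n (length w) with hn | hn
  · rw [filter_lengthSphere_eq_empty hn, Finset.card_empty, zero_smul, if_neg hn.not_ge]
  · obtain ⟨d, rfl⟩ := Nat.exists_eq_add_of_le hn
    rw [card_filter_lengthSphere_length_add, if_pos hn, Nat.add_sub_cancel_left,
      coeff_cayleySeries, nsmul_eq_mul, pow_add]
    split_ifs <;> push_cast <;> ring

theorem hasFormalSum_kappa_mul_g (w : W) :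
    HasFormalSum
      (fun x => if w ∈ bruhatIic x then HahnSeries.single (length x : ℤ) 1 *
        HahnSeries.single (length x : ℤ) ((-1) ^ length x) else 0)
      (kappa * g w) := by
  convert hasFormalSum_ofQInv_monomial_length
    fun x => if w ∈ bruhatIic x then (-1) ^ length x else 0 using 2 with x
  · rw [ofQInv_monomial, HahnSeries.single_mul_single, one_mul, ← two_mul]
    split_ifs
    · rfl
    · rw [map_zero]
  · rw [kappa_mul_g]
    congr 1
    ext n
    rw [PowerSeries.coeff_mk, sum_lengthSphere_neg_one_pow_length]

theorem jCompletion_eq_single_length_iff {b : W → ℤ⸨X⸩} :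
    jCompletion b = (fun x => HahnSeries.single (length x : ℤ) 1) ↔
      b = fun x => HahnSeries.single (length x : ℤ) ((-1) ^ length x) := by
  refine funext_iff.trans ((forall_congr' fun x => ?_).trans funext_iff.symm)
  rw [single_neg_one_pow, jCompletion]
  rcases neg_one_pow_eq_or ℤ⸨X⸩ (length x) with hx | hx
  · rw [hx, one_mul, one_mul]
  · rw [hx, neg_one_mul, neg_one_mul, neg_eq_iff_eq_neg]

theorem isAsympElement_one_iff (t : W → ℤ⸨X⸩) :
    IsAsympElement 1 t ↔ t = fun w => kappa * g w := by
  constructor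
  · rintro ⟨b, -, hb, ht⟩
    obtain rfl := jCompletion_eq_single_length_iff.mp (isPhi_asympBasis_one_iff.mp hb)
    exact funext fun w => (ht w).unique (hasFormalSum_kappa_mul_g w)
  · rintro rfl
    exact ⟨_, isNull_single_length _,
      isPhi_asympBasis_one_iff.mpr (jCompletion_eq_single_length_iff.mpr rfl),
      hasFormalSum_kappa_mul_g⟩

/-! ## Specialization of the variable -/

theorem specializes_ofQInv {q : ℕ} {p : PowerSeries ℤ} {τ : ℂ}
    (hp : HasSum (fun n : ℕ => (p.coeff n : ℂ) * ((q : ℂ)⁻¹) ^ n) τ) :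
    Specializes q (ofQInv p) τ := by
  have hsqrt : ((Real.sqrt q : ℝ) : ℂ) ^ 2 = q := by
    rw [← Complex.ofReal_pow, Real.sq_sqrt q.cast_nonneg, Complex.ofReal_natCast]
  have hinj : Function.Injective fun n : ℕ => (2 * n : ℤ) := fun m n hmn => by
    simpa using hmn
  refine (hinj.hasSum_iff fun k hk => ?_).mp (hp.congr_fun fun n => ?_)
  · rw [coeff_ofQInv_of_ne fun n hn => hk ⟨n, hn.symm⟩, Int.cast_zero, zero_mul]
  · simp only [Function.comp_apply]
    rw [coeff_ofQInv_two_mul, zpow_neg, zpow_mul, zpow_ofNat, hsqrt, zpow_natCast, inv_pow]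

theorem hasSum_cayleySeries {z : ℂ} (hz : ‖z‖ < 1) :
    HasSum (fun n : ℕ => (cayleySeries.coeff n : ℂ) * z ^ n) ((1 - z) / (1 + z)) := by
  have hne : 1 + z ≠ 0 := fun h0 => by
    rw [← neg_eq_iff_add_eq_zero.mpr h0, norm_neg, norm_one] at hz
    exact lt_irrefl _ hz
  have hgeom : HasSum (fun n : ℕ => (-z) ^ n) (1 + z)⁻¹ := by
    simpa only [sub_neg_eq_add] using hasSum_geometric_of_norm_lt_one (ξ := -z) (by rwa [norm_neg])
  have hval : (1 - z) / (1 + z) = 2 * (1 + z)⁻¹ - 1 := by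
    field_simp
    ring
  rw [hval]
  refine ((hgeom.mul_left 2).sub (hasSum_ite_eq 0 1)).congr_fun fun n => ?_
  rw [coeff_cayleySeries, neg_pow]
  rcases eq_or_ne n 0 with rfl | hn
  · norm_num
  · rw [if_neg hn, if_neg hn]
    push_cast
    ring

theorem hasSum_mul_neg_X_pow {p : PowerSeries ℤ} {z τ : ℂ}
    (hp : HasSum (fun n : ℕ => (p.coeff n : ℂ) * z ^ n) τ) (l : ℕ) :
    HasSum (fun n : ℕ => ((p * (-PowerSeries.X) ^ l).coeff n : ℂ) * z ^ n) (τ * (-z) ^ l) := by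
  refine ((add_left_injective l).hasSum_iff fun n hn => ?_).mp
    ((hp.mul_right ((-z) ^ l)).congr_fun fun n => ?_)
  · have hln : ¬ l ≤ n := fun h => hn ⟨n - l, Nat.sub_add_cancel h⟩
    rw [coeff_mul_neg_X_pow, if_neg hln, Int.cast_zero, zero_mul]
  · simp only [Function.comp_apply]
    rw [coeff_mul_neg_X_pow, if_pos (Nat.le_add_left l n), Nat.add_sub_cancel, neg_pow z]
    push_cast
    ring

theorem specializes_kappa_mul_g {q : ℕ} (hq : 1 < q) (w : W) :
    Specializes q (kappa * g w)
      ((1 - (q : ℂ)⁻¹) / (1 + (q : ℂ)⁻¹) * ((-1) ^ length w * ((q : ℂ) ^ length w)⁻¹)) := by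
  have hnorm : ‖(q : ℂ)⁻¹‖ < 1 := by
    rw [norm_inv, Complex.norm_natCast]
    exact inv_lt_one_of_one_lt₀ (Nat.one_lt_cast.mpr hq)
  rw [kappa_mul_g, ← inv_pow, ← neg_pow]
  exact specializes_ofQInv (hasSum_mul_neg_X_pow (hasSum_cayleySeries hnorm) _)

/-! ## Convolution with a double coset -/

section DoubleCoset

variable {G X : Type*} [Group G] [MulAction G X] {I : Subgroup G} {S : Set X}

theorem out_mk_smul_set (hS : ∀ i : I, i • S = S) (γ : G) :
    (Quotient.out (γ : G ⧸ I)) • S = γ • S := by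
  obtain ⟨i, hi⟩ := QuotientGroup.mk_out_eq_mul I γ
  rw [hi, mul_smul]
  exact congrArg (γ • ·) (hS i)

theorem out_smul_smul_set (hS : ∀ i : I, i • S = S) (i : I) (c : G ⧸ I) :
    Quotient.out (i • c) • S = i • Quotient.out c • S := by
  obtain ⟨γ, rfl⟩ := QuotientGroup.mk_surjective c
  rw [out_mk_smul_set hS γ, show i • (γ : G ⧸ I) = ((i * γ : G) : G ⧸ I) from rfl,
    out_mk_smul_set hS, mul_smul]
  rfl

theorem finsum_indicator_inv_smul_smul (hS : ∀ i : I, i • S = S) (c : G ⧸ I) (i : I) (y : X) :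
    ∑ᶠ d ∈ MulAction.orbit I c, S.indicator (1 : X → ℂ) ((Quotient.out d)⁻¹ • i • y) =
      ∑ᶠ d ∈ MulAction.orbit I c, S.indicator 1 ((Quotient.out d)⁻¹ • y) := by
  have hind (d : G ⧸ I) : S.indicator (1 : X → ℂ) ((Quotient.out (i • d))⁻¹ • i • y) =
      S.indicator 1 ((Quotient.out d)⁻¹ • y) := by
    refine Set.indicator_eq_indicator ?_ rfl
    simp only [← Set.mem_smul_set_iff_inv_smul_mem, out_smul_smul_set hS,
      Set.smul_mem_smul_set_iff]
  rw [← MulAction.smul_orbit i c, ← Set.image_smul,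
    finsum_mem_image (MulAction.injective i).injOn, Set.image_smul, MulAction.smul_orbit]
  exact finsum_mem_congr rfl fun d _ => hind d

variable [MeasurableSpace X] {μ : Measure X}

theorem measureReal_orbit_inter_out_smul [SMulInvariantMeasure I X μ]
    (hS : ∀ i : I, i • S = S) (w : G) (x : X) {c : G ⧸ I}
    (hc : c ∈ MulAction.orbit I (w : G ⧸ I)) :
    μ.real (MulAction.orbit I x ∩ Quotient.out c • S) =
      μ.real (MulAction.orbit I x ∩ w • S) := by
  obtain ⟨i, rfl⟩ := hc
  dsimp only
  rw [out_smul_smul_set hS, out_mk_smul_set hS, ← MulAction.smul_orbit i x,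
    ← Set.smul_set_inter, MulAction.smul_orbit, measureReal_def, measure_smul, measureReal_def]

theorem finsum_indicator_mul_measureReal_orbit [SMulInvariantMeasure I X μ]
    [MeasurableConstSMul G X] (hS : ∀ i : I, i • S = S) (hSm : MeasurableSet S) (w : G) (x : X)
    (hfin : (MulAction.orbit I (w : G ⧸ I)).Finite)
    (hx : MeasurableSet (MulAction.orbit I x)) (hx' : μ (MulAction.orbit I x) ≠ ⊤) :
    (∑ᶠ c ∈ MulAction.orbit I (w : G ⧸ I), S.indicator (1 : X → ℂ) ((Quotient.out c)⁻¹ • x)) *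
        μ.real (MulAction.orbit I x) =
      (MulAction.orbit I (w : G ⧸ I)).ncard * μ.real (MulAction.orbit I x ∩ w • S) := by
  set O := MulAction.orbit I x
  set D := MulAction.orbit I (w : G ⧸ I)
  have : IsFiniteMeasure (μ.restrict O) := ⟨by simpa using hx'.lt_top⟩
  have hind (c : G ⧸ I) : (fun y => S.indicator (1 : X → ℂ) ((Quotient.out c)⁻¹ • y)) =
      (Quotient.out c • S).indicator 1 := by
    ext y
    exact Set.indicator_eq_indicator Set.mem_smul_set_iff_inv_smul_mem.symm rfl
  have hm (c : G ⧸ I) : MeasurableSet (Quotient.out c • S) := hSm.const_smul _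
  calc _ = ∫ y in O, ∑ᶠ c ∈ D, S.indicator (1 : X → ℂ) ((Quotient.out c)⁻¹ • y) ∂μ := by
        rw [setIntegral_congr_fun
          (g := fun _ => ∑ᶠ c ∈ D, S.indicator 1 ((Quotient.out c)⁻¹ • x)) hx ?_,
          setIntegral_const, mul_comm, Complex.real_smul]
        rintro - ⟨i, rfl⟩
        exact finsum_indicator_inv_smul_smul hS _ i x
    _ = ∫ y in O, ∑ c ∈ hfin.toFinset, (Quotient.out c • S).indicator (1 : X → ℂ) y ∂μ := by
        simp only [finsum_mem_eq_finite_toFinset_sum _ hfin, ← hind, D]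
    _ = ∑ c ∈ hfin.toFinset, (μ.real (O ∩ Quotient.out c • S) : ℂ) := by
        rw [integral_finsetSum _ fun c _ => (integrable_const 1).indicator (hm c)]
        refine Finset.sum_congr rfl fun c _ => ?_
        rw [setIntegral_indicator (hm c), Pi.one_def, setIntegral_const, Complex.real_smul, mul_one]
    _ = _ := by
        rw [Finset.sum_congr rfl fun c hc => congrArg _
          (measureReal_orbit_inter_out_smul hS w x (hfin.mem_toFinset.mp hc)), Finset.sum_const,
          nsmul_eq_mul, Set.ncard_eq_toFinset_card _ hfin]

end DoubleCoset

/-! ## Iwahori orbits in the plane -/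

section Uniformizer

variable {F : Type*} [Field F] [ValuativeRel F] {ϖ : 𝒪[F]}

theorem valuation_uniformizer_pos (hϖ : Irreducible ϖ) : 0 < valuation F (ϖ : F) :=
  zero_lt_iff.mpr ((valuation F).ne_zero_iff.mpr (uniformizer_ne_zero hϖ))

theorem valuation_uniformizer_lt_one (hϖ : Irreducible ϖ) : valuation F (ϖ : F) < 1 := by
  refine lt_of_le_of_ne ϖ.2 fun h1 => hϖ.not_isUnit ?_
  exact (Valuation.integer.integers (valuation F)).isUnit_of_one
    (isUnit_iff_ne_zero.mpr (uniformizer_ne_zero hϖ)) h1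

theorem strictAnti_valuation_uniformizer_zpow (hϖ : Irreducible ϖ) :
    StrictAnti fun n : ℤ => valuation F (ϖ : F) ^ n :=
  zpow_right_strictAnti₀ (valuation_uniformizer_pos hϖ) (valuation_uniformizer_lt_one hϖ)

theorem exists_valuation_eq_zpow [IsDiscreteValuationRing 𝒪[F]] (hϖ : Irreducible ϖ) {y : F}
    (hy : y ≠ 0) : ∃ k : ℤ, valuation F y = valuation F (ϖ : F) ^ k := by
  have key (b : 𝒪[F]) (hb : b ≠ 0) : ∃ k : ℤ, valuation F (b : F) = valuation F (ϖ : F) ^ k := by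
    obtain ⟨n, u, rfl⟩ := IsDiscreteValuationRing.eq_unit_mul_pow_irreducible hb hϖ
    have hu : valuation F ((u : 𝒪[F]) : F) = 1 :=
      (Valuation.integer.integers (valuation F)).one_of_isUnit u.isUnit
    exact ⟨n, by simp [hu]⟩
  rcases le_total (valuation F y) 1 with h1 | h1
  · exact key ⟨y, h1⟩ fun h0 => hy (congrArg Subtype.val h0)
  · have hy' : valuation F y⁻¹ ≤ 1 := by
      rw [map_inv₀]
      exact inv_le_one_of_one_le₀ h1
    obtain ⟨k, hk⟩ := key ⟨y⁻¹, hy'⟩ fun h0 => inv_ne_zero hy (congrArg Subtype.val h0)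
    exact ⟨-k, by rw [zpow_neg, ← hk, map_inv₀, inv_inv]⟩

theorem valuation_lt_zpow_iff [IsDiscreteValuationRing 𝒪[F]] (hϖ : Irreducible ϖ) {y : F} {m : ℤ} :
    valuation F y < valuation F (ϖ : F) ^ m ↔ valuation F y ≤ valuation F (ϖ : F) ^ (m + 1) := by
  rcases eq_or_ne y 0 with rfl | hy
  · simp [valuation_uniformizer_pos hϖ, zpow_pos]
  · obtain ⟨k, hk⟩ := exists_valuation_eq_zpow hϖ hy
    have hanti := strictAnti_valuation_uniformizer_zpow hϖ
    rw [hk, hanti.lt_iff_gt, hanti.le_iff_ge, Int.add_one_le_iff]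

end Uniformizer

section Action

variable {F : Type*} [Field F]

/-- The standard representation of `SL₂(F)`. -/
instance : DistribMulAction SL(2, F) (Fin 2 → F) :=
  DistribMulAction.compHom _ (Matrix.SpecialLinearGroup.toLin' (n := Fin 2) (R := F))

theorem smul_apply (g : SL(2, F)) (x : Fin 2 → F) (i : Fin 2) :
    (g • x) i = g i 0 * x 0 + g i 1 * x 1 := Matrix.vec2_dotProduct _ _

instance [TopologicalSpace F] [IsTopologicalRing F] : ContinuousConstSMul SL(2, F) (Fin 2 → F) where
  continuous_const_smul _ := Continuous.matrix_mulVec continuous_const continuous_id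

variable [ValuativeRel F]

theorem valuation_diag_eq_one {g : SL(2, F)} (hg : g ∈ iwahori F) :
    valuation F (g 0 0) = 1 ∧ valuation F (g 1 1) = 1 := by
  obtain ⟨hle, hlt⟩ := hg
  have hoff : valuation F (g 0 1 * g 1 0) < 1 := by
    rw [map_mul]
    exact mul_lt_one_of_nonneg_of_lt_one_right (hle 0 1) zero_le hlt
  have hdet : g 0 0 * g 1 1 = 1 + g 0 1 * g 1 0 := by
    linear_combination (Matrix.det_fin_two _).symm.trans g.2
  have hmul : valuation F (g 0 0) * valuation F (g 1 1) = 1 := by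
    rw [← map_mul, hdet, (valuation F).map_one_add_of_lt hoff]
  constructor
  · exact le_antisymm (hle 0 0) (hmul ▸ mul_le_of_le_one_right' (hle 1 1))
  · exact le_antisymm (hle 1 1) (hmul ▸ mul_le_of_le_one_left' (hle 0 0))

theorem orbit_iwahori_vec_zero {c : F} (hc : c ≠ 0) :
    MulAction.orbit (iwahori F) ![c, 0] =
      {y | valuation F (y 0) = valuation F c ∧ valuation F (y 1) < valuation F c} := by
  have hc' : 0 < valuation F c := zero_lt_iff.mpr ((valuation F).ne_zero_iff.mpr hc)
  ext y
  constructor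
  · rintro ⟨⟨g, hg⟩, rfl⟩
    change valuation F ((g • ![c, 0]) 0) = _ ∧ valuation F ((g • ![c, 0]) 1) < _
    simpa [smul_apply, (valuation_diag_eq_one hg).1] using
      mul_lt_of_lt_one_left hc' hg.2
  · rintro ⟨hy0, hy1⟩
    have hy : y 0 ≠ 0 := (valuation F).ne_zero_iff.mp (hy0 ▸ hc'.ne')
    let g : SL(2, F) := ⟨!![y 0 / c, 0; y 1 / c, c / y 0], by simp [Matrix.det_fin_two_of, hc, hy]⟩
    have hg : g ∈ iwahori F := by
      refine ⟨Fin.forall_fin_two.mpr ⟨Fin.forall_fin_two.mpr ⟨?_, ?_⟩,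
        Fin.forall_fin_two.mpr ⟨?_, ?_⟩⟩, ?_⟩ <;>
      simp [g, hy0, hc'.ne', div_le_one₀ hc', div_lt_one₀ hc', hy1, hy1.le]
    refine ⟨⟨g, hg⟩, ?_⟩
    change g • ![c, 0] = y
    refine funext (Fin.forall_fin_two.mpr
      ⟨(smul_apply _ _ _).trans ?_, (smul_apply _ _ _).trans ?_⟩) <;> simp [g, hc]

theorem orbit_iwahori_zero_vec {c : F} (hc : c ≠ 0) :
    MulAction.orbit (iwahori F) ![0, c] =
      {y | valuation F (y 0) ≤ valuation F c ∧ valuation F (y 1) = valuation F c} := by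
  have hc' : 0 < valuation F c := zero_lt_iff.mpr ((valuation F).ne_zero_iff.mpr hc)
  ext y
  constructor
  · rintro ⟨⟨g, hg⟩, rfl⟩
    change valuation F ((g • ![0, c]) 0) ≤ _ ∧ valuation F ((g • ![0, c]) 1) = _
    simpa [smul_apply, (valuation_diag_eq_one hg).2] using
      mul_le_of_le_one_left' (hg.1 0 1)
  · rintro ⟨hy0, hy1⟩
    have hy : y 1 ≠ 0 := (valuation F).ne_zero_iff.mp (hy1 ▸ hc'.ne')
    let g : SL(2, F) := ⟨!![c / y 1, y 0 / c; 0, y 1 / c], by simp [Matrix.det_fin_two_of, hc, hy]⟩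
    have hg : g ∈ iwahori F := by
      refine ⟨Fin.forall_fin_two.mpr ⟨Fin.forall_fin_two.mpr ⟨?_, ?_⟩,
        Fin.forall_fin_two.mpr ⟨?_, ?_⟩⟩, ?_⟩ <;> simp [g, hy0, hc'.ne', div_le_one₀ hc', hy1]
    refine ⟨⟨g, hg⟩, ?_⟩
    change g • ![0, c] = y
    refine funext (Fin.forall_fin_two.mpr
      ⟨(smul_apply _ _ _).trans ?_, (smul_apply _ _ _).trans ?_⟩) <;> simp [g, hc]

theorem exists_mem_orbit_iwahori {x : Fin 2 → F} (hx : x ≠ 0) :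
    ∃ c ≠ 0, x ∈ MulAction.orbit (iwahori F) ![c, 0] ∨ x ∈ MulAction.orbit (iwahori F) ![0, c] := by
  rcases lt_or_ge (valuation F (x 1)) (valuation F (x 0)) with hlt | hle
  · have hx0 : x 0 ≠ 0 := (valuation F).ne_zero_iff.mp (zero_le.trans_lt hlt).ne'
    exact ⟨x 0, hx0, .inl (by rw [orbit_iwahori_vec_zero hx0]; exact ⟨rfl, hlt⟩)⟩
  · have hx1 : x 1 ≠ 0 := by
      contrapose! hx
      have hx0 : x 0 = 0 := by simpa [hx] using hle
      exact funext (Fin.forall_fin_two.mpr ⟨hx0, hx⟩)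
    exact ⟨x 1, hx1, .inr (by rw [orbit_iwahori_zero_vec hx1]; exact ⟨hle, rfl⟩)⟩

end Action

/-! ## Haar measure of the Iwahori orbits -/

section Haar

theorem addHaar_eq_zero_of_subset_submodule {𝕜 V : Type*} [DivisionRing 𝕜] [TopologicalSpace 𝕜]
    [(𝓝[≠] (0 : 𝕜)).NeBot] [AddCommGroup V] [TopologicalSpace V] [IsTopologicalAddGroup V]
    [LocallyCompactSpace V] [Module 𝕜 V] [ContinuousSMul 𝕜 V] [MeasurableSpace V] [BorelSpace V]
    (μ : Measure V) [μ.IsAddHaarMeasure] [μ.InnerRegularCompactLTTop] {U : Submodule 𝕜 V}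
    (hU : U ≠ ⊤) {E : Set V} (hE : MeasurableSet E) (hEU : E ⊆ U) (hμE : μ E ≠ ⊤) : μ E = 0 := by
  by_contra hpos
  have hnhds := Measure.sub_mem_nhds_zero_of_addHaar_pos_ne_top μ E hE
    (pos_iff_ne_zero.mpr hpos) hμE
  have hsub : E - E ⊆ U := by
    rintro - ⟨x, hx, y, hy, rfl⟩
    exact U.sub_mem (hEU hx) (hEU hy)
  have : (𝓝[{c : 𝕜 | IsUnit c}] 0).NeBot := by simpa only [isUnit_iff_ne_zero]
  exact hU (U.eq_top_of_nonempty_interior'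
    ⟨0, mem_interior_iff_mem_nhds.mpr (mem_of_superset hnhds hsub)⟩)

variable {F : Type*} [Field F] [ValuativeRel F] [TopologicalSpace F]

section IsValuativeTopology

variable [IsValuativeTopology F]

theorem isOpen_valuation_lt (c : F) : IsOpen {y | valuation F y < valuation F c} := by
  simpa only [Valuation.restrict_lt_iff] using
    Valuation.isOpen_ball (v := valuation F) ((valuation F).restrict c)

theorem isOpen_valuation_le {c : F} (hc : c ≠ 0) : IsOpen {y | valuation F y ≤ valuation F c} := by
  simpa only [Valuation.restrict_le_iff] using
    Valuation.isOpen_closedBall (v := valuation F) (r := (valuation F).restrict c) (by simpa)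

theorem isOpen_valuation_eq {c : F} (hc : c ≠ 0) : IsOpen {y | valuation F y = valuation F c} := by
  simpa only [Valuation.restrict_inj] using
    Valuation.isOpen_sphere (v := valuation F) (r := (valuation F).restrict c) (by simpa)

instance [ValuativeRel.IsNontrivial F] : (𝓝[≠] (0 : F)).NeBot := by
  rw [← mem_closure_iff_nhdsWithin_neBot,
    mem_closure_iff_nhds_basis (IsValuativeTopology.hasBasis_nhds_zero F)]
  intro γ _
  obtain ⟨y, hy⟩ := ValuativeRel.valuation_surjective γ.val
  obtain ⟨t, ht, ht1⟩ := Valuation.IsNontrivial.exists_lt_one (v := valuation F)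
  have hy0 : y ≠ 0 := (valuation F).ne_zero_iff.mp (hy ▸ γ.ne_zero)
  exact ⟨y * t, mul_ne_zero hy0 ht, by
    simpa [hy] using mul_lt_of_lt_one_right γ.zero_lt ht1⟩

theorem isOpen_orbit_iwahori {x : Fin 2 → F} (hx : x ≠ 0) :
    IsOpen (MulAction.orbit (iwahori F) x) := by
  have hcont (i : Fin 2) : Continuous fun y : Fin 2 → F => y i := continuous_apply i
  obtain ⟨c, hc, hmem | hmem⟩ := exists_mem_orbit_iwahori hx
  · rw [MulAction.orbit_eq_iff.mpr hmem, orbit_iwahori_vec_zero hc]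
    exact ((isOpen_valuation_eq hc).preimage (hcont 0)).inter
      ((isOpen_valuation_lt c).preimage (hcont 1))
  · rw [MulAction.orbit_eq_iff.mpr hmem, orbit_iwahori_zero_vec hc]
    exact ((isOpen_valuation_le hc).preimage (hcont 0)).inter
      ((isOpen_valuation_eq hc).preimage (hcont 1))

end IsValuativeTopology

variable [IsNonarchimedeanLocalField F] [MeasurableSpace (Fin 2 → F)] (μ : Measure (Fin 2 → F))

theorem measure_orbit_iwahori_ne_top [IsFiniteMeasureOnCompacts μ] (x : Fin 2 → F) :
    μ (MulAction.orbit (iwahori F) x) ≠ ⊤ := by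
  obtain ⟨i, hi⟩ := Finite.exists_max fun i => valuation F (x i)
  have hcompact :
      IsCompact (Set.univ.pi fun _ : Fin 2 => {y : F | valuation F y ≤ valuation F (x i)}) :=
    isCompact_univ_pi fun _ => IsNonarchimedeanLocalField.isCompact_closedBall F _
  refine measure_ne_top_of_subset ?_ hcompact.measure_ne_top
  rintro - ⟨⟨g, hg⟩, rfl⟩ k -
  have hle (l : Fin 2) : valuation F (g k l * x l) ≤ valuation F (x i) := by
    rw [map_mul]
    exact mul_le_of_le_one_of_le (hg.1 k l) (hi l)
  suffices valuation F (g k 0 * x 0 + g k 1 * x 1) ≤ valuation F (x i) by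
    simpa [smul_apply]
  exact (valuation F).map_add_le (hle 0) (hle 1)

variable [μ.IsAddHaarMeasure]

theorem measureReal_orbit_iwahori_ne_zero {x : Fin 2 → F} (hx : x ≠ 0) :
    μ.real (MulAction.orbit (iwahori F) x) ≠ 0 :=
  ENNReal.toReal_ne_zero.mpr
    ⟨(isOpen_orbit_iwahori hx).measure_ne_zero μ (MulAction.nonempty_orbit x),
      measure_orbit_iwahori_ne_top μ x⟩

instance [BorelSpace (Fin 2 → F)] [μ.Regular] : SMulInvariantMeasure (iwahori F) (Fin 2 → F) μ := by
  have hx : ![(1 : F), 0] ≠ 0 := by simp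
  refine ((smulInvariantMeasure_tfae (iwahori F) μ).out 0 4).mpr fun g E => ?_
  have hchar : distribHaarChar (Fin 2 → F) (g : SL(2, F)) = 1 :=
    distribHaarChar_eq_of_measure_smul_eq_mul (μ := μ)
      (s := MulAction.orbit (iwahori F) ![(1 : F), 0])
      ((isOpen_orbit_iwahori hx).measure_ne_zero μ (MulAction.nonempty_orbit _))
      (measure_orbit_iwahori_ne_top μ _)
      ((congrArg μ (MulAction.smul_orbit g ![(1 : F), 0])).trans (one_mul _).symm)
  exact (distribHaarChar_mul μ (g : SL(2, F)) E).symm.trans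
    (by rw [hchar, ENNReal.coe_one, one_mul])

end Haar

/-! ## Cardinality of the cells -/

theorem ncard_range_eq_card_quotient {R X : Type*} [CommRing R] (J : Ideal R) {f : R → X}
    (hf : ∀ b c, f b = f c ↔ c - b ∈ J) : (Set.range f).ncard = Nat.card (R ⧸ J) := by
  have hker (b c : R) : Ideal.Quotient.mk J b = Ideal.Quotient.mk J c ↔ f b = f c := by
    rw [hf, eq_comm, Ideal.Quotient.mk_eq_mk_iff_sub_mem]
  let fbar : R ⧸ J → X := fun b => f b.out
  have hfbar (b : R) : fbar (Ideal.Quotient.mk J b) = f b := (hker _ _).mp (Quotient.out_eq _)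
  have hrange : Set.range f = Set.range fbar := by
    rw [← Ideal.Quotient.mk_surjective.range_comp fbar]
    exact congrArg Set.range (funext fun b => (hfbar b).symm)
  have hinj : Function.Injective fbar := by
    intro b c hbc
    rw [← Quotient.out_eq b, ← Quotient.out_eq c]
    exact (hker _ _).mpr hbc
  rw [hrange, ← Nat.card_coe_set_eq, Nat.card_range_of_injective hinj]

theorem ncard_orbit_eq_card_quotient {G R : Type*} [Group G] [CommRing R] {I : Subgroup G} {w : G}
    {J : Ideal R} {θ : R → G} (hθ : ∀ b, θ b ∈ I) (hsub : ∀ b c, (θ b)⁻¹ * θ c = θ (c - b))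
    (hstab : ∀ b, w⁻¹ * θ b * w ∈ I ↔ b ∈ J)
    (hsurj : ∀ g ∈ I, ∃ b, w⁻¹ * ((θ b)⁻¹ * g) * w ∈ I) :
    (MulAction.orbit I (w : G ⧸ I)).ncard = Nat.card (R ⧸ J) := by
  have hmk (g g' : G) : ((g * w : G) : G ⧸ I) = (g' * w : G) ↔ w⁻¹ * (g⁻¹ * g') * w ∈ I := by
    rw [QuotientGroup.eq, mul_inv_rev, mul_assoc, mul_assoc, mul_assoc]
  have horbit : MulAction.orbit I (w : G ⧸ I) = Set.range fun b => ((θ b * w : G) : G ⧸ I) := by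
    ext c
    constructor
    · rintro ⟨⟨g, hg⟩, rfl⟩
      exact (hsurj g hg).imp fun b hb => (hmk _ _).mpr hb
    · rintro ⟨b, rfl⟩
      exact ⟨⟨θ b, hθ b⟩, rfl⟩
  rw [horbit]
  exact ncard_range_eq_card_quotient J fun b c => by rw [hmk, hsub, hstab]

section Length

/-- The exponent `k` for which conjugation by a representative of `w` carries the Iwahori subgroup
to the matrices with upper right entry in `ϖ^k 𝒪` and lower left entry in `ϖ^(1-k) 𝒪`. -/
def rootShift : W → ℤ
  | .r n => let k : ℤ := n; 2 * k
  | .sr n => let k : ℤ := n; 1 - 2 * k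

theorem natAbs_rootShift (w : W) : (rootShift w).natAbs = length w := by
  rw [← length_reducedWord]
  rcases w with (n : ℤ) | (n : ℤ)
  · by_cases h : 0 ≤ n <;> simp [rootShift, reducedWord, h, length_altWord, Int.natAbs_mul]
  · by_cases h : n ≤ 0 <;> simp [rootShift, reducedWord, h, length_altWord] <;> omega

theorem neg_one_pow_length_r (n : ℤ) : (-1 : ℝ) ^ length (.r n) = 1 :=
  Even.neg_one_pow (by rw [← natAbs_rootShift, Int.natAbs_even]; exact even_two_mul n)

theorem neg_one_pow_length_sr (n : ℤ) : (-1 : ℝ) ^ length (.sr n) = -1 :=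
  Odd.neg_one_pow (by
    rw [← natAbs_rootShift, Int.natAbs_odd]
    exact odd_one.sub_even (even_two_mul n))

end Length

section RootSubgroups

variable {F : Type*} [Field F]

theorem coe_inv_weylRep_r_mul_mul {ϖ : F} (hϖ : ϖ ≠ 0) (n : ℤ) (g : SL(2, F)) :
    ((weylRep ϖ hϖ (.r n))⁻¹ * g * weylRep ϖ hϖ (.r n) : SL(2, F)) =
      !![g 0 0, ϖ ^ (-(2 * n)) * g 0 1; ϖ ^ (2 * n) * g 1 0, g 1 1] := by
  have hrep : (weylRep ϖ hϖ (.r n) : SL(2, F)) = !![ϖ ^ n, 0; 0, ϖ ^ (-n)] := rfl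
  rw [Matrix.SpecialLinearGroup.coe_mul, Matrix.SpecialLinearGroup.coe_mul,
    Matrix.SpecialLinearGroup.coe_inv, hrep, Matrix.adjugate_fin_two_of,
    Matrix.eta_fin_two (g : Matrix (Fin 2) (Fin 2) F), Matrix.mul_fin_two, Matrix.mul_fin_two]
  ext i k
  fin_cases i <;> fin_cases k <;> simp [two_mul, zpow_add₀ hϖ] <;> field_simp

theorem coe_inv_weylRep_sr_mul_mul {ϖ : F} (hϖ : ϖ ≠ 0) (n : ℤ) (g : SL(2, F)) :
    ((weylRep ϖ hϖ (.sr n))⁻¹ * g * weylRep ϖ hϖ (.sr n) : SL(2, F)) =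
      !![g 1 1, -(ϖ ^ (-(2 * n)) * g 1 0); -(ϖ ^ (2 * n) * g 0 1), g 0 0] := by
  have hrep : (weylRep ϖ hϖ (.sr n) : SL(2, F)) = !![0, -ϖ ^ (-n); ϖ ^ n, 0] := rfl
  rw [Matrix.SpecialLinearGroup.coe_mul, Matrix.SpecialLinearGroup.coe_mul,
    Matrix.SpecialLinearGroup.coe_inv, hrep, Matrix.adjugate_fin_two_of,
    Matrix.eta_fin_two (g : Matrix (Fin 2) (Fin 2) F), Matrix.mul_fin_two, Matrix.mul_fin_two]
  ext i k
  fin_cases i <;> fin_cases k <;> simp [two_mul, zpow_add₀ hϖ] <;> field_simp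

variable [ValuativeRel F]

theorem cell_eq_orbit {ϖ : F} (hϖ : ϖ ≠ 0) (w : W) :
    cell ϖ hϖ w = MulAction.orbit (iwahori F) (weylRep ϖ hϖ w : SL(2, F) ⧸ iwahori F) := by
  ext c
  constructor
  · rintro ⟨i, hi, rfl⟩
    exact ⟨⟨i, hi⟩, rfl⟩
  · rintro ⟨⟨i, hi⟩, rfl⟩
    exact ⟨i, hi, rfl⟩

/-- The upper unitriangular root subgroup of the Iwahori subgroup. -/
def upperUnipotent (b : 𝒪[F]) : SL(2, F) := ⟨!![1, (b : F); 0, 1], by simp [Matrix.det_fin_two_of]⟩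

/-- The lower unitriangular root subgroup of the Iwahori subgroup, scaled by the uniformizer. -/
def lowerUnipotent (ϖ b : 𝒪[F]) : SL(2, F) :=
  ⟨!![1, 0; (ϖ * b : F), 1], by simp [Matrix.det_fin_two_of]⟩

theorem mem_iwahori_iff {g : SL(2, F)} : g ∈ iwahori F ↔
    valuation F (g 0 0) ≤ 1 ∧ valuation F (g 0 1) ≤ 1 ∧ valuation F (g 1 0) < 1 ∧
      valuation F (g 1 1) ≤ 1 := by
  refine (and_congr_left' (Fin.forall_fin_two.trans
    (and_congr Fin.forall_fin_two Fin.forall_fin_two))).trans ?_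
  have := @le_of_lt _ _ (valuation F (g 1 0)) 1
  tauto

theorem valuation_zpow_mul_le_one_iff {ϖ : F} (hϖ : ϖ ≠ 0) (n : ℤ) (y : F) :
    valuation F (ϖ ^ (-n) * y) ≤ 1 ↔ valuation F y ≤ valuation F ϖ ^ n := by
  have hpos : 0 < valuation F ϖ ^ n :=
    zpow_pos (zero_lt_iff.mpr ((valuation F).ne_zero_iff.mpr hϖ)) n
  rw [map_mul, map_zpow₀, zpow_neg, inv_mul_le_one₀ hpos]

theorem valuation_zpow_mul_lt_one_iff {ϖ : F} (hϖ : ϖ ≠ 0) (n : ℤ) (y : F) :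
    valuation F (ϖ ^ n * y) < 1 ↔ valuation F y < valuation F ϖ ^ (-n) := by
  have hpos : 0 < valuation F ϖ ^ n :=
    zpow_pos (zero_lt_iff.mpr ((valuation F).ne_zero_iff.mpr hϖ)) n
  rw [map_mul, map_zpow₀, ← lt_inv_mul_iff₀ hpos, mul_one, zpow_neg]

theorem mem_span_pow_iff_valuation_le {ϖ b : 𝒪[F]} {n : ℕ} :
    b ∈ Ideal.span {ϖ ^ n} ↔ valuation F (b : F) ≤ valuation F (ϖ : F) ^ n := by
  rw [Ideal.mem_span_singleton, (Valuation.integer.integers (valuation F)).dvd_iff_le, map_pow,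
    map_pow]
  rfl

theorem upperUnipotent_mem_iwahori (b : 𝒪[F]) : upperUnipotent b ∈ iwahori F := by
  have hb : valuation F (b : F) ≤ 1 := b.2
  rw [mem_iwahori_iff]
  simpa [upperUnipotent] using hb

theorem lowerUnipotent_mem_iwahori {ϖ : 𝒪[F]} (hϖ : Irreducible ϖ) (b : 𝒪[F]) :
    lowerUnipotent ϖ b ∈ iwahori F := by
  have hb : valuation F (ϖ * b : F) < 1 := by
    rw [map_mul]
    exact mul_lt_one_of_nonneg_of_lt_one_left zero_le (valuation_uniformizer_lt_one hϖ) b.2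
  rw [mem_iwahori_iff]
  simpa [lowerUnipotent] using hb

theorem coe_inv_upperUnipotent_mul (b : 𝒪[F]) (g : SL(2, F)) :
    ((upperUnipotent b)⁻¹ * g : SL(2, F)) =
      !![g 0 0 - b * g 1 0, g 0 1 - b * g 1 1; g 1 0, g 1 1] := by
  rw [Matrix.SpecialLinearGroup.coe_mul, Matrix.SpecialLinearGroup.coe_inv,
    Matrix.eta_fin_two (g : Matrix (Fin 2) (Fin 2) F)]
  simp [upperUnipotent, Matrix.adjugate_fin_two_of, sub_eq_add_neg]

theorem coe_inv_lowerUnipotent_mul (ϖ b : 𝒪[F]) (g : SL(2, F)) :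
    ((lowerUnipotent ϖ b)⁻¹ * g : SL(2, F)) =
      !![g 0 0, g 0 1; g 1 0 - ϖ * b * g 0 0, g 1 1 - ϖ * b * g 0 1] := by
  rw [Matrix.SpecialLinearGroup.coe_mul, Matrix.SpecialLinearGroup.coe_inv,
    Matrix.eta_fin_two (g : Matrix (Fin 2) (Fin 2) F)]
  simp [lowerUnipotent, Matrix.adjugate_fin_two_of, sub_eq_neg_add]

variable [IsDiscreteValuationRing 𝒪[F]] {ϖ : 𝒪[F]}

theorem inv_mul_weylRep_mem_iwahori_iff (hϖ : Irreducible ϖ) (w : W) {g : SL(2, F)}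
    (hg : g ∈ iwahori F) :
    (weylRep (ϖ : F) (uniformizer_ne_zero hϖ) w)⁻¹ * g *
        weylRep (ϖ : F) (uniformizer_ne_zero hϖ) w ∈ iwahori F ↔
      valuation F (g 0 1) ≤ valuation F (ϖ : F) ^ rootShift w ∧
        valuation F (g 1 0) ≤ valuation F (ϖ : F) ^ (1 - rootShift w) := by
  have hϖ0 := uniformizer_ne_zero hϖ
  obtain ⟨hg00, hg11⟩ := valuation_diag_eq_one hg
  rw [mem_iwahori_iff]
  rcases w with (n : ℤ) | (n : ℤ)
  · have hup := valuation_zpow_mul_le_one_iff hϖ0 (2 * n) (g 0 1)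
    have hlow := valuation_zpow_mul_lt_one_iff hϖ0 (2 * n) (g 1 0)
    rw [valuation_lt_zpow_iff hϖ, neg_add_eq_sub] at hlow
    simp only [coe_inv_weylRep_r_mul_mul, rootShift, ← hup, ← hlow]
    simp [hg00, hg11]
  · have hup := valuation_zpow_mul_le_one_iff hϖ0 (2 * n) (g 1 0)
    have hlow := valuation_zpow_mul_lt_one_iff hϖ0 (2 * n) (g 0 1)
    rw [valuation_lt_zpow_iff hϖ, neg_add_eq_sub] at hlow
    simp only [coe_inv_weylRep_sr_mul_mul, rootShift, sub_sub_cancel, ← hup, ← hlow]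
    simp [hg00, hg11, and_comm]

theorem ncard_cell_of_rootShift_nonneg (hϖ : Irreducible ϖ) {w : W} (hw : 0 ≤ rootShift w) :
    (cell (ϖ : F) (uniformizer_ne_zero hϖ) w).ncard =
      Nat.card (𝒪[F] ⧸ Ideal.span {ϖ ^ length w}) := by
  have hlen : rootShift w = length w := by rw [← natAbs_rootShift, Int.natAbs_of_nonneg hw]
  rw [cell_eq_orbit]
  refine ncard_orbit_eq_card_quotient upperUnipotent_mem_iwahori ?_ ?_ ?_
  · intro b c
    ext i k
    rw [coe_inv_upperUnipotent_mul]
    fin_cases i <;> fin_cases k <;> simp [upperUnipotent]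
  · intro b
    rw [inv_mul_weylRep_mem_iwahori_iff hϖ w (upperUnipotent_mem_iwahori b),
      mem_span_pow_iff_valuation_le, hlen]
    simp [upperUnipotent]
  · intro g hg
    have hg11 := (valuation_diag_eq_one hg).2
    have hg11' : g 1 1 ≠ 0 := (valuation F).ne_zero_iff.mp (hg11 ▸ one_ne_zero)
    let b : 𝒪[F] := ⟨g 0 1 / g 1 1, by
      rw [Valuation.mem_integer_iff, map_div₀, hg11, div_one]
      exact hg.1 0 1⟩
    refine ⟨b, (inv_mul_weylRep_mem_iwahori_iff hϖ w
      (mul_mem (inv_mem (upperUnipotent_mem_iwahori b)) hg)).mpr ?_⟩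
    have hlow : valuation F (g 1 0) ≤ valuation F (ϖ : F) ^ (1 : ℤ) := by
      simpa using (valuation_lt_zpow_iff hϖ (m := 0)).mp (by simpa using hg.2)
    have hanti := (strictAnti_valuation_uniformizer_zpow hϖ).antitone
    rw [coe_inv_upperUnipotent_mul]
    simpa [b, hg11'] using hlow.trans (hanti (by omega : 1 - rootShift w ≤ 1))

theorem ncard_cell_of_rootShift_nonpos (hϖ : Irreducible ϖ) {w : W} (hw : rootShift w ≤ 0) :
    (cell (ϖ : F) (uniformizer_ne_zero hϖ) w).ncard =
      Nat.card (𝒪[F] ⧸ Ideal.span {ϖ ^ length w}) := by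
  have hlen : rootShift w = -length w := by
    rw [← natAbs_rootShift, Int.ofNat_natAbs_of_nonpos hw, neg_neg]
  rw [cell_eq_orbit]
  refine ncard_orbit_eq_card_quotient (lowerUnipotent_mem_iwahori hϖ) ?_ ?_ ?_
  · intro b c
    ext i k
    rw [coe_inv_lowerUnipotent_mul]
    fin_cases i <;> fin_cases k <;> simp [lowerUnipotent, mul_sub]
  · intro b
    have hpos := valuation_uniformizer_pos hϖ
    rw [inv_mul_weylRep_mem_iwahori_iff hϖ w (lowerUnipotent_mem_iwahori hϖ b),
      mem_span_pow_iff_valuation_le, hlen, sub_neg_eq_add, zpow_add₀ hpos.ne']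
    simp [lowerUnipotent, hpos]
  · intro g hg
    have hg00 := (valuation_diag_eq_one hg).1
    have hg00' : g 0 0 ≠ 0 := (valuation F).ne_zero_iff.mp (hg00 ▸ one_ne_zero)
    have hlow : valuation F (g 1 0) ≤ valuation F (ϖ : F) := by
      simpa using (valuation_lt_zpow_iff hϖ (m := 0)).mp (by simpa using hg.2)
    let b : 𝒪[F] := ⟨g 1 0 / (ϖ * g 0 0), by
      rw [Valuation.mem_integer_iff, map_div₀, map_mul, hg00, mul_one]
      exact div_le_one_of_le₀ hlow zero_le⟩
    refine ⟨b, (inv_mul_weylRep_mem_iwahori_iff hϖ w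
      (mul_mem (inv_mem (lowerUnipotent_mem_iwahori hϖ b)) hg)).mpr ?_⟩
    have hanti := (strictAnti_valuation_uniformizer_zpow hϖ).antitone
    have hb : g 1 0 - ϖ * b * g 0 0 = 0 := by
      have hϖ0 := uniformizer_ne_zero hϖ
      simp only [b]
      field_simp
      ring
    rw [coe_inv_lowerUnipotent_mul]
    simpa [hb] using (hg.1 0 1).trans (by simpa using hanti hw)

end RootSubgroups

section CellCard

variable {F : Type*} [Field F] [ValuativeRel F] [TopologicalSpace F] [IsNonarchimedeanLocalField F]
  {ϖ : 𝒪[F]}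

theorem card_quotient_span_uniformizer_pow (hϖ : Irreducible ϖ) (n : ℕ) :
    Nat.card (𝒪[F] ⧸ Ideal.span {ϖ ^ n}) = Nat.card 𝓀[F] ^ n := by
  rw [← Ideal.span_singleton_pow, ← hϖ.maximalIdeal_eq, ← Submodule.cardQuot_apply,
    cardQuot_pow_of_prime (IsDiscreteValuationRing.not_a_field _), Submodule.cardQuot_apply]
  rfl

theorem ncard_cell (hϖ : Irreducible ϖ) (w : W) :
    (cell (ϖ : F) (uniformizer_ne_zero hϖ) w).ncard = Nat.card 𝓀[F] ^ length w := by
  rw [← card_quotient_span_uniformizer_pow hϖ]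
  exact (le_total 0 (rootShift w)).elim (ncard_cell_of_rootShift_nonneg hϖ)
    (ncard_cell_of_rootShift_nonpos hϖ)

theorem finite_cell (hϖ : Irreducible ϖ) (w : W) :
    (cell (ϖ : F) (uniformizer_ne_zero hϖ) w).Finite :=
  Set.finite_of_ncard_ne_zero (by
    rw [ncard_cell hϖ]
    exact pow_ne_zero _ Nat.card_pos.ne')

end CellCard

/-! ## Tilings by translates under the affine Weyl group -/

theorem hasSum_of_hasSum_r_of_hasSum_sr {M : Type*} [AddCommMonoid M] [TopologicalSpace M]
    [ContinuousAdd M] {f : W → M} {a b : M} (hr : HasSum (fun n : ℤ => f (.r n)) a)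
    (hsr : HasSum (fun n : ℤ => f (.sr n)) b) : HasSum f (a + b) :=
  DihedralGroup.equivSum.symm.hasSum_iff.mp (hr.sum hsr)

theorem hasSum_measureReal_inter {X ι : Type*} [MeasurableSpace X] {μ : Measure X} [Countable ι]
    {B : ι → Set X} (hB : ∀ n, MeasurableSet (B n)) (hdisj : Pairwise (Function.onFun Disjoint B))
    {E : Set X} (hE : μ E ≠ ⊤) (hnull : μ (E \ ⋃ n, B n) = 0) :
    HasSum (fun n => μ.real (E ∩ B n)) (μ.real E) := by
  have htsum : ∑' n, μ (E ∩ B n) = μ E := by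
    have hrestrict := measure_iUnion (μ := μ.restrict E) hdisj hB
    simp only [Measure.restrict_apply (hB _), Measure.restrict_apply (MeasurableSet.iUnion hB),
      Set.inter_comm _ E] at hrestrict
    rw [← hrestrict, ← measure_inter_add_sdiff E (MeasurableSet.iUnion hB), hnull, add_zero]
  have hsum := ENNReal.hasSum_toReal (htsum.trans_ne hE)
  rwa [← ENNReal.tsum_toReal_eq fun n => measure_ne_top_of_subset Set.inter_subset_left hE,
    htsum] at hsum

/-- The vectors whose `i`-th coordinate has the valuation of `ϖ ^ n`. As `n` runs through `ℤ`, these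
sets tile the complement of the line where the `i`-th coordinate vanishes. -/
def coordLevel {F : Type*} [Field F] [ValuativeRel F] (ϖ : F) (i : Fin 2) (n : ℤ) :
    Set (Fin 2 → F) :=
  {x | valuation F (x i) = valuation F ϖ ^ n}

section WeylTranslates

variable {F : Type*} [Field F] {ϖ : F} (hϖ : ϖ ≠ 0)

theorem inv_weylRep_r_smul (n : ℤ) (x : Fin 2 → F) :
    (weylRep ϖ hϖ (.r n))⁻¹ • x = ![ϖ ^ (-n) * x 0, ϖ ^ n * x 1] := by
  rw [inv_smul_eq_iff]
  refine funext (Fin.forall_fin_two.mpr ⟨?_, ?_⟩) <;> rw [smul_apply] <;>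
    simp [weylRep, zpow_ne_zero n hϖ]

theorem inv_weylRep_sr_smul (n : ℤ) (x : Fin 2 → F) :
    (weylRep ϖ hϖ (.sr n))⁻¹ • x = ![ϖ ^ (-n) * x 1, -(ϖ ^ n * x 0)] := by
  rw [inv_smul_eq_iff]
  refine funext (Fin.forall_fin_two.mpr ⟨?_, ?_⟩) <;> rw [smul_apply] <;>
    simp [weylRep, zpow_ne_zero n hϖ]

theorem weylRep_smul_setOf_mul_mem {A : Set F} (hA : ∀ y, -y ∈ A ↔ y ∈ A) (w : W) :
    weylRep ϖ hϖ w • {x : Fin 2 → F | x 0 * x 1 ∈ A} = {x | x 0 * x 1 ∈ A} := by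
  have hcancel (n : ℤ) (y z : F) : ϖ ^ (-n) * y * (ϖ ^ n * z) = y * z := by
    rw [mul_mul_mul_comm, ← zpow_add₀ hϖ, neg_add_cancel, zpow_zero, one_mul]
  ext x
  rw [Set.mem_smul_set_iff_inv_smul_mem]
  rcases w with (n : ℤ) | (n : ℤ)
  · simp [inv_weylRep_r_smul, -zpow_neg, hcancel]
  · simp [inv_weylRep_sr_smul, -zpow_neg, hcancel, hA, mul_comm (x 1)]

variable [ValuativeRel F]

theorem exists_weylRep_smul_coordLevel (i : Fin 2) (m : ℤ) :
    ∃ e : ℤ ≃ ℤ, ∀ n : ℤ,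
      weylRep ϖ hϖ (.r n) • coordLevel ϖ i m = coordLevel ϖ i (e n) ∧
      weylRep ϖ hϖ (.sr n) • coordLevel ϖ i m = coordLevel ϖ (1 - i) (e n) := by
  have h0 : valuation F ϖ ≠ 0 := (valuation F).ne_zero_iff.mpr hϖ
  have hsub (n : ℤ) (y : F) : valuation F ϖ ^ n * valuation F y = valuation F ϖ ^ m ↔
      valuation F y = valuation F ϖ ^ (m - n) := by
    rw [zpow_sub₀ h0, eq_div_iff (zpow_ne_zero n h0), mul_comm]
  have hadd (n : ℤ) (y : F) : (valuation F ϖ ^ n)⁻¹ * valuation F y = valuation F ϖ ^ m ↔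
      valuation F y = valuation F ϖ ^ (m + n) := by
    rw [← zpow_neg, hsub, sub_neg_eq_add]
  revert i
  refine Fin.forall_fin_two.mpr ⟨⟨Equiv.addLeft m, fun n => ⟨?_, ?_⟩⟩,
    ⟨Equiv.subLeft m, fun n => ⟨?_, ?_⟩⟩⟩
  all_goals
    ext x
    simp [Set.mem_smul_set_iff_inv_smul_mem, inv_weylRep_r_smul, inv_weylRep_sr_smul, coordLevel,
      hsub, hadd]

end WeylTranslates

section Tiling

variable {F : Type*} [Field F] [ValuativeRel F] [TopologicalSpace F] [IsNonarchimedeanLocalField F]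
  {ϖ : 𝒪[F]} [MeasurableSpace (Fin 2 → F)] {μ : Measure (Fin 2 → F)} [BorelSpace (Fin 2 → F)]

theorem measurableSet_coordLevel (hϖ : Irreducible ϖ) (i : Fin 2) (n : ℤ) :
    MeasurableSet (coordLevel (ϖ : F) i n) := by
  have hopen := isOpen_valuation_eq (zpow_ne_zero n (uniformizer_ne_zero hϖ))
  simp only [map_zpow₀] at hopen
  exact (hopen.preimage (continuous_apply (A := fun _ : Fin 2 => F) i)).measurableSet

theorem hasSum_measureReal_inter_coordLevel [μ.IsAddHaarMeasure] [μ.Regular] (hϖ : Irreducible ϖ)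
    {E : Set (Fin 2 → F)} (hE : MeasurableSet E) (hμE : μ E ≠ ⊤) (i : Fin 2) :
    HasSum (fun n => μ.real (E ∩ coordLevel (ϖ : F) i n)) (μ.real E) := by
  have hmeas := measurableSet_coordLevel hϖ i
  refine hasSum_measureReal_inter hmeas ?_ hμE ?_
  · intro n n' hne
    refine Set.disjoint_left.mpr fun x hx hx' => hne ?_
    exact (strictAnti_valuation_uniformizer_zpow hϖ).injective (hx.symm.trans hx')
  · let axis : Submodule F (Fin 2 → F) := LinearMap.ker (LinearMap.proj i)
    have haxis : axis ≠ ⊤ := by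
      intro htop
      have : Pi.single i 1 ∈ axis := htop ▸ Submodule.mem_top
      simp [axis] at this
    refine addHaar_eq_zero_of_subset_submodule (U := axis) μ haxis
      (hE.diff (.iUnion hmeas)) ?_ (measure_ne_top_of_subset Set.sdiff_subset hμE)
    rintro x ⟨-, hx⟩
    by_contra hxi
    exact hx (Set.mem_iUnion.mpr (exists_valuation_eq_zpow hϖ hxi))

theorem hasSum_neg_one_pow_length_mul_measureReal [μ.IsAddHaarMeasure] [μ.Regular]
    (hϖ : Irreducible ϖ) {A : Set F} (hA : IsOpen A) (hneg : ∀ y, -y ∈ A ↔ y ∈ A) (i : Fin 2)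
    (m : ℤ) {E : Set (Fin 2 → F)} (hE : MeasurableSet E) (hμE : μ E ≠ ⊤) :
    HasSum (fun w => (-1) ^ length w * μ.real (E ∩
      weylRep (ϖ : F) (uniformizer_ne_zero hϖ) w •
        ({x | x 0 * x 1 ∈ A} ∩ coordLevel (ϖ : F) i m))) 0 := by
  have hϖ0 := uniformizer_ne_zero hϖ
  let R : Set (Fin 2 → F) := {x | x 0 * x 1 ∈ A}
  have hR : MeasurableSet R :=
    (hA.preimage ((continuous_apply 0).mul (continuous_apply 1))).measurableSet
  have htile := hasSum_measureReal_inter_coordLevel hϖ (hE.inter hR)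
    (measure_ne_top_of_subset Set.inter_subset_left hμE)
  obtain ⟨e, he⟩ := exists_weylRep_smul_coordLevel hϖ0 i m
  have hinter (w : W) : E ∩ weylRep (ϖ : F) hϖ0 w • (R ∩ coordLevel (ϖ : F) i m) =
      E ∩ R ∩ weylRep (ϖ : F) hϖ0 w • coordLevel (ϖ : F) i m := by
    rw [Set.smul_set_inter, weylRep_smul_setOf_mul_mem hϖ0 hneg, Set.inter_assoc]
  simp only [show {x : Fin 2 → F | x 0 * x 1 ∈ A} = R from rfl, hinter]
  rw [← add_neg_cancel (μ.real (E ∩ R))]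
  refine hasSum_of_hasSum_r_of_hasSum_sr ((e.hasSum_iff.mpr (htile i)).congr_fun fun n => ?_)
    ((e.hasSum_iff.mpr (htile (1 - i))).neg.congr_fun fun n => ?_)
  · rw [(he n).1, neg_one_pow_length_r, one_mul, Function.comp_apply]
  · rw [(he n).2, neg_one_pow_length_sr, neg_one_mul, Function.comp_apply]

end Tiling

/-! ## Vanishing of the convolutions -/

section Orbits

variable {F : Type*} [Field F] [ValuativeRel F] {ϖ : 𝒪[F]}

theorem psi_eq_indicator_orbit [IsDiscreteValuationRing 𝒪[F]] (hϖ : Irreducible ϖ) (m : ℤ) :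
    psi (ϖ : F) m = fun x => (MulAction.orbit (iwahori F) ![(ϖ : F) ^ m, 0]).indicator 1 x.1 := by
  ext x
  rw [orbit_iwahori_vec_zero (zpow_ne_zero m (uniformizer_ne_zero hϖ))]
  simp only [map_zpow₀, valuation_lt_zpow_iff hϖ]
  rfl

theorem phi_eq_indicator_orbit (hϖ : Irreducible ϖ) (m : ℤ) :
    phi (ϖ : F) m = fun x => (MulAction.orbit (iwahori F) ![0, (ϖ : F) ^ m]).indicator 1 x.1 := by
  ext x
  rw [orbit_iwahori_zero_vec (zpow_ne_zero m (uniformizer_ne_zero hϖ))]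
  simp only [map_zpow₀]
  rfl

end Orbits

section Vanishing

variable {F : Type*} [Field F] [ValuativeRel F] [TopologicalSpace F] [IsNonarchimedeanLocalField F]
  {ϖ : 𝒪[F]}

theorem conv_indicator_mul_measureReal_orbit [MeasurableSpace (Fin 2 → F)]
    [BorelSpace (Fin 2 → F)] (μ : Measure (Fin 2 → F)) [μ.IsAddHaarMeasure] [μ.Regular]
    (hϖ : Irreducible ϖ) {S : Set (Fin 2 → F)} (hS : ∀ i : iwahori F, i • S = S)
    (hSm : MeasurableSet S) (w : W) (x : Plane F) :
    conv (ϖ : F) (uniformizer_ne_zero hϖ) w (fun y => S.indicator 1 y.1) x *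
        μ.real (MulAction.orbit (iwahori F) x.1) =
      Nat.card 𝓀[F] ^ length w * μ.real (MulAction.orbit (iwahori F) x.1 ∩
        weylRep (ϖ : F) (uniformizer_ne_zero hϖ) w • S) := by
  have hcell := cell_eq_orbit (uniformizer_ne_zero hϖ) w
  rw [← Nat.cast_pow, ← ncard_cell hϖ, hcell,
    ← finsum_indicator_mul_measureReal_orbit hS hSm _ x.1 (hcell ▸ finite_cell hϖ w)
      (isOpen_orbit_iwahori x.2).measurableSet (measure_orbit_iwahori_ne_top μ x.1), conv, hcell]
  rfl

theorem actsTo_zero_of_orbit_eq (hϖ : Irreducible ϖ) {x₀ : Fin 2 → F} (hx₀ : x₀ ≠ 0) {A : Set F}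
    (hA : IsOpen A) (hneg : ∀ y, -y ∈ A ↔ y ∈ A) {i : Fin 2} {m : ℤ}
    (horbit : MulAction.orbit (iwahori F) x₀ = {x | x 0 * x 1 ∈ A} ∩ coordLevel (ϖ : F) i m)
    (c : ℂ) :
    ActsTo (ϖ : F) (uniformizer_ne_zero hϖ)
      (fun w => c * ((-1) ^ length w * ((Nat.card 𝓀[F] : ℂ) ^ length w)⁻¹))
      (fun x => (MulAction.orbit (iwahori F) x₀).indicator 1 x.1) 0 := by
  intro x
  borelize (Fin 2 → F)
  let μ : Measure (Fin 2 → F) := .addHaar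
  have hμ : (μ.real (MulAction.orbit (iwahori F) x.1) : ℂ) ≠ 0 :=
    Complex.ofReal_ne_zero.mpr (measureReal_orbit_iwahori_ne_zero μ x.2)
  have hq : (Nat.card 𝓀[F] : ℂ) ≠ 0 := Nat.cast_ne_zero.mpr Nat.card_pos.ne'
  have hsum := hasSum_neg_one_pow_length_mul_measureReal (μ := μ) hϖ hA hneg i m
    (isOpen_orbit_iwahori x.2).measurableSet (measure_orbit_iwahori_ne_top μ x.1)
  rw [← horbit, ← Complex.hasSum_ofReal] at hsum
  have hsum' := hsum.mul_left (c * (μ.real (MulAction.orbit (iwahori F) x.1) : ℂ)⁻¹)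
  rw [Complex.ofReal_zero, mul_zero] at hsum'
  refine hsum'.congr_fun fun w => ?_
  have hconv := conv_indicator_mul_measureReal_orbit μ hϖ (fun k => MulAction.smul_orbit k x₀)
    (isOpen_orbit_iwahori hx₀).measurableSet w x
  rw [eq_div_of_mul_eq hμ hconv]
  push_cast
  field_simp

theorem actsTo_psi_zero (hϖ : Irreducible ϖ) (m : ℤ) (c : ℂ) :
    ActsTo (ϖ : F) (uniformizer_ne_zero hϖ)
      (fun w => c * ((-1) ^ length w * ((Nat.card 𝓀[F] : ℂ) ^ length w)⁻¹)) (psi (ϖ : F) m) 0 := by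
  have hϖm := zpow_ne_zero m (uniformizer_ne_zero hϖ)
  have hpos : 0 < valuation F (ϖ : F) ^ m := zpow_pos (valuation_uniformizer_pos hϖ) m
  rw [psi_eq_indicator_orbit hϖ]
  refine actsTo_zero_of_orbit_eq hϖ (by simpa using hϖm) (i := 0) (m := m)
    (isOpen_valuation_lt ((ϖ : F) ^ m * (ϖ : F) ^ m)) (fun y => by simp) ?_ c
  rw [orbit_iwahori_vec_zero hϖm]
  ext x
  simp +contextual [coordLevel, and_comm, hpos]

theorem actsTo_phi_zero (hϖ : Irreducible ϖ) (m : ℤ) (c : ℂ) :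
    ActsTo (ϖ : F) (uniformizer_ne_zero hϖ)
      (fun w => c * ((-1) ^ length w * ((Nat.card 𝓀[F] : ℂ) ^ length w)⁻¹)) (phi (ϖ : F) m) 0 := by
  have hϖm := zpow_ne_zero m (uniformizer_ne_zero hϖ)
  have hpos : 0 < valuation F (ϖ : F) ^ m := zpow_pos (valuation_uniformizer_pos hϖ) m
  rw [phi_eq_indicator_orbit hϖ]
  refine actsTo_zero_of_orbit_eq hϖ (by simpa using hϖm) (i := 1) (m := m)
    (isOpen_valuation_le (mul_ne_zero hϖm hϖm)) (fun y => by simp) ?_ c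
  rw [orbit_iwahori_zero_vec hϖm]
  ext x
  simp +contextual [coordLevel, hpos, and_congr_left_iff]

end Vanishing

end AffineSL2

end

theorem propositiont1 {F : Type*} [Field F] [ValuativeRel F] [TopologicalSpace F]
    [IsNonarchimedeanLocalField F] (ϖ : 𝒪[F]) (hϖ : Irreducible ϖ) :
    ∃ t : AffineSL2.W → ℤ⸨X⸩,
      (∀ t', AffineSL2.IsAsympElement 1 t' ↔ t' = t) ∧
      (∃ κ : ℤ⸨X⸩, κ * (1 + HahnSeries.single 2 1) = 1 - HahnSeries.single 2 1 ∧
        ∀ w, t w = κ * AffineSL2.g w) ∧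
      ∃ τ : AffineSL2.W → ℂ,
        (∀ w, AffineSL2.Specializes (Nat.card 𝓀[F]) (t w) (τ w)) ∧
        ∀ m : ℤ,
          AffineSL2.ActsTo (ϖ : F) (AffineSL2.uniformizer_ne_zero hϖ) τ (AffineSL2.psi (ϖ : F) m) 0 ∧
          AffineSL2.ActsTo (ϖ : F) (AffineSL2.uniformizer_ne_zero hϖ) τ (AffineSL2.phi (ϖ : F) m) 0 := by
  have hq : 1 < Nat.card 𝓀[F] := Finite.one_lt_card
  exact ⟨fun w => AffineSL2.kappa * AffineSL2.g w, AffineSL2.isAsympElement_one_iff,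
    ⟨AffineSL2.kappa, AffineSL2.kappa_mul, fun _ => rfl⟩, _,
    AffineSL2.specializes_kappa_mul_g hq,
    fun m => ⟨AffineSL2.actsTo_psi_zero hϖ m _, AffineSL2.actsTo_phi_zero hϖ m _⟩⟩
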